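/- **Theorem.** Let $q$ be a prime power and $n\ge 1$; write $\mathrm{Tr}=\mathrm{Tr}_{q^n/q}$. The weight $w(v)$ of $v\in\mathbb F_{q^n}^{n+1}$ is the $\mathbb F_q$-dimension of the span of its entries. Let $\mathcal C\subseteq \mathbb F_{q^n}^{n+1}$ be a linear $[n+1,3,1]_{q^n/q}$ rank metric code, i.e. an $\mathbb F_{q^n}$-subspace of dimension $3$ with minimum rank distance $1$. A *system associated with* $\mathcal C$ is the $\mathbb F_q$-span $U\subseteq\mathbb F_{q^n}^3$ of the columns of a generator matrix of $\mathcal C$. Assume that $\mathcal C$ is *$q$-non-degenerate*: the columns of any generator matrix are $\mathbb F_q$-linearly independent and, for an associated system $U$, there is a $2$-dimensional $\mathbb F_{q^n}$-subspace $\overline W$ of $\mathbb F_{q^n}^3$ with $\dim_{\mathbb F_q}(U\cap \overline W)=2$ and $\dim_{\mathbb F_{q^n}}\langle U\cap \overline W\rangle_{\mathbb F_{q^n}}=2$ (this does not depend on $U$). Two codes $\mathcal C,\mathcal C'$ are *semilinearly equivalent* if $\mathcal C'=\mathcal C^\rho A$ for some $\rho\in\mathrm{Aut}(\mathbb F_{q^n})$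 and $A\in\mathrm{GL}(n+1,q)$. For an $\mathbb F_q$-linear map $f:\mathbb F_{q^n}\to\mathbb F_{q^n}$ (that is, a $q$-polynomial) and an $\mathbb F_q$-basis $\xi_1,\dots,\xi_n$ of $\mathbb F_{q^n}$, let $\mathcal C_f$ be the code generated by the rows of $$\begin{pmatrix}\xi_1&\cdots&\xi_n&0\\ f(\xi_1)&\cdots&f(\xi_n)&0\\ 0&\cdots&0&1\end{pmatrix}.$$ Statements on $\mathcal C_f$ below hold for every choice of the basis. Let $L_f$ be the set of points $\langle (x,f(x))\rangle_{\mathbb F_{q^n}}$, $x\ne0$, of $\mathrm{PG}(1,q^n)$; the weight of a point is the $\mathbb F_q$-dimension of its intersection with $\{(x,f(x)) : x\in\mathbb F_{q^n}\}$; $f$ is an *$i$-club polynomial* if one point of $L_f$ has weight $i$ and all its other points have weight $1$. Then: 0. Every system $U$ associated with $\mathcal C$ defines an $\mathbb F_q$-linear blocking set of Rédei type in $\mathrm{PG}(2,q^n)$: $\dim_{\mathbb F_q}U=n+1$, the set $L_U=\{\langle u\rangle_{\mathbb F_{q^n}} : u\in U\setminus\{0\}\}$ meets every line, and there is a line $\ell=\mathrm{PG}(W,\mathbb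 F_{q^n})$ such that $|L_U|=q^n+t$ with $t=|L_U\cap\ell|<q^n$, $\dim_{\mathbb F_q}(U\cap W)=n$ and $U=(U\cap W)\oplus\langle v\rangle_{\mathbb F_q}$ for some $v\notin W$. 1. If $\mathcal C$ has more than $q^n-1$ codewords of weight one, then $\mathcal C$ is semilinearly equivalent to $\mathcal C_{f}$ with $f=\mathrm{Tr}$. 2. If $n=4$, then $\mathcal C$ is semilinearly equivalent to $\mathcal C_f$ for one of the following polynomials $f$: - $x^q+\delta x^{q^3}$ with $\delta\in\mathbb F_{q^4}$, $\mathrm N_{q^4/q}(\delta)\neq1$; - $\mathrm{Tr}(x)$; - $x^q-x^{q^3}$; - $\mathrm{Tr}(\xi_2x)+b\,\mathrm{Tr}(\xi_3x)$, where $\mathbb F_q(b)=\mathbb F_{q^4}$ and $(\xi_0,\xi_1,\xi_2,\xi_3)$ is the trace-dual basis of an $\mathbb F_q$-basis of the form $(1,b,b^2+\omega,\omega b)$; - $\mathrm{Tr}(\xi_2x)+b\,\mathrm{Tr}(\xi_3x)$, where $(\xi_0,\xi_1,\xi_2,\xi_3)$ is the trace-dual basis of an $\mathbb F_q$-basis of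 the form $(1,a,\omega,\omega b)$ and $a,b$ do not both lie in $\mathbb F_{q^2}$. 3. If $\mathcal C$ has exactly $q^n-1$ codewords of weight one, exactly $(q^n-1)q^2$ codewords of weight two, and all the remaining nonzero codewords, with at most $(q^n-1)(q^n-q^2)$ exceptions, have weight at least $n-1$, then $\mathcal C$ is semilinearly equivalent to $\mathcal C_f$ for an $(n-2)$-club polynomial $$f(x)=\mathrm{Tr}(\xi x)+b\,\mathrm{Tr}(\eta x),\qquad b\in\mathbb F_{q^n}\setminus\mathbb F_q,\ \xi,\eta\in\mathbb F_{q^n}^*,$$ such that, with $t=[\mathbb F_q(b):\mathbb F_q]$, the orthogonal of $\langle\xi,\eta\rangle_{\mathbb F_q}$ under $(x,y)\mapsto\mathrm{Tr}(xy)$ is $\overline S\oplus c\langle 1,b,\dots,b^{t-3}\rangle_{\mathbb F_q}$ for some $c\in\mathbb F_{q^n}^*$ and some $\mathbb F_{q^t}$-subspace $\overline S$ of $\mathbb F_{q^n}$ of dimension $n/t-1$ (the second summand is $0$ if $t=2$). -/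

import Mathlib

open Module IntermediateField
open scoped LinearAlgebra.Projectivization

noncomputable section

namespace RankMetric

/-! ### Rank metric codes

Throughout, `F` is the field with `q` elements and `K` is its extension of degree `n`. -/

section Codes

variable (F : Type*) {K : Type*} [Field F] [Field K] [Algebra F K] {N k : ℕ}

/-- The rank weight of a vector: the `F`-dimension of the span of its entries. -/
def rankWeight (v : Fin N → K) : ℕ :=
  finrank F (Submodule.span F (Set.range v))

/-- The rank distance. -/
def rankDist (x y : Fin N → K) : ℕ :=
  rankWeight F (x - y)

/-- `C` is an `[N, k, d]` rank metric code: it has dimension `k` and minimum distance `d`. -/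
def IsCode (C : Submodule K (Fin N → K)) (k d : ℕ) : Prop :=
  finrank K C = k ∧
    IsLeast {r : ℕ | ∃ x ∈ C, ∃ y ∈ C, x ≠ y ∧ r = rankDist F x y} d

/-- The number of codewords of `C` whose weight satisfies `P`. -/
def numCodewords (C : Submodule K (Fin N → K)) (P : ℕ → Prop) : ℕ :=
  {c : Fin N → K | c ∈ C ∧ P (rankWeight F c)}.ncard

/-- `G` is a generator matrix of `C`: its rows form a basis of `C`. -/
def IsGeneratorMatrix (C : Submodule K (Fin N → K)) (G : Matrix (Fin k) (Fin N) K) : Prop :=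
  LinearIndependent K G.row ∧ Submodule.span K (Set.range G.row) = C

/-- The columns of any generator matrix are linearly independent over `F`. -/
def IsNondegenerate (C : Submodule K (Fin N → K)) : Prop :=
  ∀ (k : ℕ) (G : Matrix (Fin k) (Fin N) K), IsGeneratorMatrix C G → LinearIndependent F G.col

/-- `U` is a system associated with `C`: the `F`-span of the columns of a generator matrix. -/
def IsAssociatedSystem (C : Submodule K (Fin N → K)) (U : Submodule F (Fin k → K)) : Prop :=
  ∃ G : Matrix (Fin k) (Fin N) K,
    IsGeneratorMatrix C G ∧ U = Submodule.span F (Set.range G.col)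

/-- A code of dimension 3 is `q`-non-degenerate if it is non-degenerate and, for an associated
system `U`, there is a 2-dimensional `K`-subspace `W` such that `U ∩ W` has `F`-dimension 2 and
spans a `K`-subspace of dimension 2. (Associated systems of a code differ by a `K`-linear
automorphism, so the choice of `U` does not matter.) -/
def IsQNondegenerate (C : Submodule K (Fin N → K)) : Prop :=
  IsNondegenerate F C ∧
    ∃ U : Submodule F (Fin 3 → K), IsAssociatedSystem F C U ∧
      ∃ W : Submodule K (Fin 3 → K), finrank K W = 2 ∧
        finrank F (U ⊓ W.restrictScalars F : Submodule F (Fin 3 → K)) = 2 ∧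
        finrank K (Submodule.span K
          ((U ⊓ W.restrictScalars F : Submodule F (Fin 3 → K)) : Set (Fin 3 → K))) = 2

/-- `C' = C ^ ρ A` for an automorphism `ρ` of `K` and an invertible matrix `A` over `F`. -/
def SemilinearlyEquivalent (C C' : Submodule K (Fin N → K)) : Prop :=
  ∃ (ρ : K ≃+* K) (A : GL (Fin N) F),
    (C' : Set (Fin N → K)) =
      (fun v : Fin N → K =>
        Matrix.vecMul (fun i => ρ (v i)) ((A : Matrix (Fin N) (Fin N) F).map (algebraMap F K))) '' C

end Codes

/-! ### Linear sets and blocking sets -/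

section Geometry

variable (F : Type*) {K V : Type*} [Field F] [Field K] [Algebra F K]
  [AddCommGroup V] [Module K V] [Module F V] [IsScalarTower F K V]

variable {F} in
/-- The linear set `L_U` of the points spanned by the nonzero vectors of `U`. -/
def linearSet (K : Type*) [Field K] [Module K V] (U : Submodule F V) : Set (ℙ K V) :=
  {p | ∃ (u : V) (hu : u ≠ 0), u ∈ U ∧ p = Projectivization.mk K u hu}

variable {F} in
/-- The weight of the projective subspace of `W` in `L_U`. -/
def setWeight (U : Submodule F V) (W : Submodule K V) : ℕ :=
  finrank F (U ⊓ W.restrictScalars F : Submodule F V)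

/-- The points of the projective subspace of `W`. -/
def pointsOf (W : Submodule K V) : Set (ℙ K V) :=
  {p | p.submodule ≤ W}

/-- A set of points of a projective plane that meets every line. -/
def IsBlockingSet (B : Set (ℙ K V)) : Prop :=
  ∀ W : Submodule K V, finrank K W = 2 → (B ∩ pointsOf W).Nonempty

/-- The line of `W` meets `B` in exactly `t` points, where `|B| = |K| + t` and `t < |K|`. -/
def IsRedeiLine (B : Set (ℙ K V)) (W : Submodule K V) : Prop :=
  finrank K W = 2 ∧
    ∃ t : ℕ, t < Nat.card K ∧ B.ncard = Nat.card K + t ∧ (B ∩ pointsOf W).ncard = t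

variable {F} in
/-- `U` defines an `F`-linear blocking set of Rédei type: `L_U` has rank `n + 1`, it is a blocking
set, and it has a Rédei line meeting it in a linear set of rank `n`, so that `U` is the sum of an
`n`-dimensional subspace inside that line and of one further vector. -/
def IsLinearRedeiBlockingSet (U : Submodule F (Fin 3 → K)) : Prop :=
  finrank F U = finrank F K + 1 ∧ IsBlockingSet (linearSet K U) ∧
    ∃ W : Submodule K (Fin 3 → K), IsRedeiLine (linearSet K U) W ∧
      setWeight U W = finrank F K ∧
      ∃ v : Fin 3 → K, v ∉ W ∧ U = (U ⊓ W.restrictScalars F) ⊔ Submodule.span F {v}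

variable {F} in
/-- `f` is an `i`-club polynomial: all points but one of the linear set `L_f` of the points
`⟨(x, f x)⟩` have weight one and the remaining point has weight `i`. -/
def IsClubPolynomial (i : ℕ) (f : K →ₗ[F] K) : Prop :=
  ∃ P ∈ linearSet K f.graph, setWeight f.graph P.submodule = i ∧
    ∀ Q ∈ linearSet K f.graph, Q ≠ P → setWeight f.graph Q.submodule = 1

end Geometry

/-! ### The polynomials and the codes they define

The `q`-polynomials over `K`, modulo `x ^ (q ^ n) - x`, are the `F`-linear maps `K → K`. -/

section Polynomials

variable {F K : Type*} [Field F] [Field K] [Algebra F K]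

/-- The trace from `K` to `F`, as a map with values in `K`. -/
def Tr (F : Type*) {K : Type*} [Field F] [Field K] [Algebra F K] (x : K) : K :=
  algebraMap F K (Algebra.trace F K x)

/-- `f x = Tr (ξ x) + b Tr (η x)` with `b ∉ F` and `ξ, η ≠ 0`, such that the orthogonal of `⟨ξ, η⟩`
under the trace form is `S ⊕ c ⟨1, b, …, b ^ (t - 3)⟩`, where `t = [F(b) : F]`, `c ≠ 0` and `S` is
an `F(b)`-subspace of dimension `n / t - 1` (the second summand is zero for `t = 2`). -/
def IsTraceClubForm (f : K →ₗ[F] K) : Prop :=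
  ∃ b ξ η c : K, b ∉ Set.range (algebraMap F K) ∧ ξ ≠ 0 ∧ η ≠ 0 ∧ c ≠ 0 ∧
    (∀ x, f x = Tr F (ξ * x) + b * Tr F (η * x)) ∧
    ∃ S : Submodule F⟮b⟯ K,
      finrank F F⟮b⟯ * (finrank F⟮b⟯ S + 1) = finrank F K ∧
      Disjoint (S.restrictScalars F)
        (Submodule.span F ((fun i : ℕ => c * b ^ i) '' Set.Iio (finrank F F⟮b⟯ - 2))) ∧
      ∀ x : K, (∀ y ∈ Submodule.span F {ξ, η}, Algebra.trace F K (y * x) = 0) ↔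
        x ∈ S.restrictScalars F ⊔
          Submodule.span F ((fun i : ℕ => c * b ^ i) '' Set.Iio (finrank F F⟮b⟯ - 2))

/-- `f x = Tr (ξ₂ x) + b Tr (ξ₃ x)`, where `(ξ₀, ξ₁, ξ₂, ξ₃)` is the basis dual to
`(e₀, e₁, e₂, e₃)` under the trace form. -/
def IsDualBasisForm (e : Fin 4 → K) (b : K) (f : K →ₗ[F] K) : Prop :=
  LinearIndependent F e ∧
    ∃ ξ : Fin 4 → K, (∀ i j, Algebra.trace F K (e i * ξ j) = if i = j then 1 else 0) ∧
      ∀ x, f x = Tr F (ξ 2 * x) + b * Tr F (ξ 3 * x)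

/-- The list of polynomials for `n = 4`:
* `x ^ q + δ x ^ (q ^ 3)` with `N(δ) ≠ 1` (all points of `L_f` have weight one);
* the trace (one point of weight three, the others of weight one);
* `x ^ q - x ^ (q ^ 3)` (one point of weight two, the others of weight one);
* `Tr (ξ₂ x) + b Tr (ξ₃ x)` for the dual of a basis `(1, b, b ^ 2 + ω, ω b)` with `F(b) = K`
  (one point of weight two, the others of weight one);
* `Tr (ξ₂ x) + b Tr (ξ₃ x)` for the dual of a basis `(1, a, ω, ω b)`, where `a` and `b` do not
  both lie in the subfield of order `q ^ 2` (two or `q + 1` points of weight two, the others of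
  weight one). -/
def IsRankFourForm (f : K →ₗ[F] K) : Prop :=
  (∃ δ : K, Algebra.norm F δ ≠ 1 ∧
    ∀ x, f x = x ^ Nat.card F + δ * x ^ (Nat.card F ^ 3)) ∨
  (∀ x, f x = Tr F x) ∨
  (∀ x, f x = x ^ Nat.card F - x ^ (Nat.card F ^ 3)) ∨
  (∃ b ω : K, F⟮b⟯ = ⊤ ∧ IsDualBasisForm ![1, b, b ^ 2 + ω, ω * b] b f) ∨
  (∃ a b ω : K, ¬ (a ^ (Nat.card F ^ 2) = a ∧ b ^ (Nat.card F ^ 2) = b) ∧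
    IsDualBasisForm ![1, a, ω, ω * b] b f)

/-- The matrix with rows `(ξ₁, …, ξₙ, 0)`, `(f ξ₁, …, f ξₙ, 0)` and `(0, …, 0, 1)`. -/
def genMatrix {n : ℕ} (ξ : Fin n → K) (f : K → K) : Matrix (Fin 3) (Fin (n + 1)) K :=
  Matrix.of ![Fin.snoc ξ 0, Fin.snoc (fun i => f (ξ i)) 0, Fin.snoc (fun _ => 0) 1]

/-- The code generated by the rows of `genMatrix ξ f`. -/
def genCode {n : ℕ} (ξ : Fin n → K) (f : K → K) : Submodule K (Fin (n + 1) → K) :=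
  Submodule.span K (Set.range (genMatrix ξ f).row)

end Polynomials

end RankMetric

end

/-!
A codeword of weight one provides coordinates in which the codewords of `C` are the maps
`(x, s) ↦ g x + s • z` on `K × F`, where `z : K` is arbitrary and `g` runs through a
two-dimensional `K`-space `D` of `F`-linear endomorphisms of `K` that contains the identity. A
semilinear equivalence between `C` and `C_f` amounts to a choice of `u, v` spanning `D` with `u`
bijective and `f ∘ u = v`. The weight of the codeword `(g, z)` is the dimension of `range g + ⟨z⟩`,
so counting the codewords of small weight controls the ranks of the elements of `D`.

An element of rank one is a multiple of a trace form. If `f ∈ D` has range `⟨1, b⟩` and the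
elements of `D` that are not multiples of `f` have rank at least `n - 1`, then `f` is a club
polynomial. Its kernel `S` and `b S` do not span `K`, hence `S` is the orthogonal of `⟨θ, θ b⟩` for
some `θ`, and the structure of `S` follows by taking the trace in two stages, from `K` to `F(b)`
and from `F(b)` to `F`.

For `n = 4` the space `D` may contain two independent elements of rank two, whose kernels are then
disjoint, or a single one up to multiples, which is the club case. If all its nonzero elements have
rank at least three, view `D` as a line of `PG(3, K)`. The alternating forms over `F` that vanish
on `D` have dimension at least two, and some combination of them over the field of order `q ^ 2` is
degenerate. Its radical is a line that is stable under the square of the Frobenius and meets both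
`D` and its Frobenius conjugate, so that `D` is spanned by some `a` and `c` with
`c = α a ^ q + β a ^ (q ^ 3)`.
-/

namespace RankMetric

section DimensionCounts

lemma finrank_map_add_finrank_inf_ker {k V V' : Type*} [Field k] [AddCommGroup V] [Module k V]
    [AddCommGroup V'] [Module k V'] (U : Submodule k V) [FiniteDimensional k U] (g : V →ₗ[k] V') :
    finrank k (U.map g) + finrank k (U ⊓ g.ker : Submodule k V) = finrank k U := by
  rw [← (g.domRestrict U).finrank_range_add_finrank_ker, LinearMap.range_domRestrict,
    LinearMap.ker_domRestrict, ← Submodule.map_comap_subtype, Submodule.finrank_map_subtype_eq]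

lemma exists_prod_equiv_of_finrank_range_eq_one {k V W M : Type*} [Field k] [AddCommGroup V]
    [Module k V] [FiniteDimensional k V] [AddCommGroup W] [Module k W] [AddCommGroup M]
    [Module k M] [FiniteDimensional k M] {L : V →ₗ[k] W} (hL : finrank k L.range = 1)
    (hV : finrank k V = finrank k M + 1) :
    ∃ (Φ : (M × k) ≃ₗ[k] V) (w : W), w ≠ 0 ∧ ∀ x s, L (Φ (x, s)) = s • w := by
  have hker : finrank k M = finrank k L.ker := by
    have := L.finrank_range_add_finrank_ker
    omega
  obtain ⟨a, ha⟩ : ∃ a, L a ≠ 0 := by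
    by_contra! h
    have hL0 : L = 0 := LinearMap.ext h
    rw [hL0, LinearMap.range_zero, finrank_bot] at hL
    omega
  let e : M ≃ₗ[k] L.ker := LinearEquiv.ofFinrankEq _ _ hker
  let Ψ : (M × k) →ₗ[k] V := (L.ker.subtype ∘ₗ e.toLinearMap).coprod (.toSpanSingleton k V a)
  have hLΨ : ∀ x s, L (Ψ (x, s)) = s • L a := fun x s => by simp [Ψ]
  have hinj : Function.Injective Ψ := by
    rw [injective_iff_map_eq_zero]
    rintro ⟨x, s⟩ h
    have hs : s • L a = 0 := by rw [← hLΨ x s, h, map_zero]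
    obtain rfl : s = 0 := (smul_eq_zero.1 hs).resolve_right ha
    simpa [Ψ] using h
  exact ⟨.ofInjectiveOfFinrankEq Ψ hinj (by rw [finrank_prod, finrank_self, hV]), L a, ha, hLΨ⟩

lemma linearIndependent_pair_iff_finrank_span {k V : Type*} [Field k] [AddCommGroup V] [Module k V]
    {u v : V} : LinearIndependent k ![u, v] ↔ finrank k (Submodule.span k {u, v}) = 2 := by
  rw [linearIndependent_iff_card_eq_finrank_span, Fintype.card_fin, Set.finrank,
    Matrix.range_cons_cons_empty, eq_comm]

lemma span_pair_eq_of_finrank_eq_two {k V : Type*} [Field k] [AddCommGroup V] [Module k V]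
    {W : Submodule k V} (hW : finrank k W = 2) {u v : V} (hu : u ∈ W) (hv : v ∈ W)
    (huv : LinearIndependent k ![u, v]) : Submodule.span k {u, v} = W := by
  have := FiniteDimensional.of_finrank_pos (hW ▸ two_pos : 0 < finrank k W)
  refine Submodule.eq_of_le_of_finrank_eq ?_ ?_
  · exact Submodule.span_le.2 (Set.insert_subset hu (Set.singleton_subset_iff.2 hv))
  · rw [linearIndependent_pair_iff_finrank_span.1 huv, hW]

lemma exists_span_pair_eq_of_finrank_eq_two {k V : Type*} [Field k] [AddCommGroup V] [Module k V]
    {W : Submodule k V} (hW : finrank k W = 2) : ∃ u v, Submodule.span k {u, v} = W := by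
  have := FiniteDimensional.of_finrank_pos (hW ▸ two_pos : 0 < finrank k W)
  let B := finBasisOfFinrankEq k W hW
  have hrange : Set.range (W.subtype ∘ B) = {(B 0 : V), (B 1 : V)} := by
    ext v
    simp [Fin.exists_fin_two, eq_comm]
  refine ⟨B 0, B 1, ?_⟩
  rw [← hrange, Set.range_comp, ← Submodule.map_span, B.span_eq, Submodule.map_top,
    Submodule.range_subtype]

end DimensionCounts

section FunctionSpace

variable {F K V V' : Type*} [Field F] [Field K] [Algebra F K] [AddCommGroup V] [Module F V]
  [AddCommGroup V'] [Module F V'] {N k : ℕ}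

/-- The codewords of `C`, a codeword `c` being read as the `F`-linear map on `V` with the values
`c j` at the vectors `β j` of a basis. A change of the basis amounts to the multiplication of `C` by
an invertible matrix over `F`. -/
noncomputable def functionSpace (β : Basis (Fin N) F V) (C : Submodule K (Fin N → K)) :
    Submodule K (V →ₗ[F] K) :=
  C.map (β.constr K).toLinearMap

variable {β : Basis (Fin N) F V} {C : Submodule K (Fin N → K)}

lemma constr_mem_functionSpace {c : Fin N → K} : β.constr K c ∈ functionSpace β C ↔ c ∈ C :=
  (Submodule.mem_map_equiv C).trans (by simp)

lemma mem_functionSpace {g : V →ₗ[F] K} : g ∈ functionSpace β C ↔ (fun j => g (β j)) ∈ C :=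
  Submodule.mem_map_equiv C

lemma finrank_functionSpace : finrank K (functionSpace β C) = finrank K C :=
  LinearEquiv.finrank_map_eq _ _

lemma mem_functionSpace_map (e : V ≃ₗ[F] V') {g : V' →ₗ[F] K} :
    g ∈ functionSpace (β.map e) C ↔ g ∘ₗ e.toLinearMap ∈ functionSpace β C := by
  simp [mem_functionSpace]

lemma finrank_range_constr (β : Basis (Fin N) F V) (c : Fin N → K) :
    finrank F (β.constr K c).range = rankWeight F c := by
  rw [Basis.constr_range, rankWeight]

lemma numCodewords_eq_ncard_functionSpace (β : Basis (Fin N) F V) (C : Submodule K (Fin N → K))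
    (P : ℕ → Prop) :
    numCodewords F C P = {g | g ∈ functionSpace β C ∧ P (finrank F g.range)}.ncard := by
  rw [numCodewords, ← Set.ncard_image_of_injective _ (β.constr K).injective]
  congr 1
  ext g
  obtain ⟨c, rfl⟩ := (β.constr K).surjective g
  simp [constr_mem_functionSpace, finrank_range_constr]

lemma vecMul_toMatrix_eq_constr (β : Basis (Fin N) F V) (β' : Basis (Fin k) F V)
    (c : Fin N → K) :
    Matrix.vecMul c ((β.toMatrix β').map (algebraMap F K)) = fun j => β.constr K c (β' j) := by
  ext j
  simp [Matrix.vecMul, dotProduct, Basis.constr_apply_fintype, Basis.toMatrix_apply,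
    Algebra.smul_def, mul_comm]

lemma semilinearlyEquivalent_of_functionSpace_eq {β' : Basis (Fin N) F V}
    {C' : Submodule K (Fin N → K)} (h : functionSpace β C = functionSpace β' C') :
    SemilinearlyEquivalent F C C' := by
  let _ := β.invertibleToMatrix β'
  refine ⟨RingEquiv.refl K, unitOfInvertible (β.toMatrix β'), Set.ext fun c' => ?_⟩
  have hA : ∀ c : Fin N → K, Matrix.vecMul c ((β.toMatrix β').map (algebraMap F K)) =
      (β'.constr K).symm (β.constr K c) := vecMul_toMatrix_eq_constr β β'
  simp only [RingEquiv.refl_apply, val_unitOfInvertible, hA, Set.mem_image, SetLike.mem_coe,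
    LinearEquiv.symm_apply_eq]
  rw [← constr_mem_functionSpace (β := β'), ← h]
  simp only [← constr_mem_functionSpace (β := β)]
  constructor
  · exact fun hc' => ⟨(β.constr K).symm (β'.constr K c'), by simpa using hc',
      (β.constr K).apply_symm_apply _⟩
  · rintro ⟨c, hc, hcc'⟩
    rwa [← hcc']

lemma exists_isGeneratorMatrix (C : Submodule K (Fin N → K)) :
    ∃ G : Matrix (Fin (finrank K C)) (Fin N) K, IsGeneratorMatrix C G := by
  let B := finBasis K C
  refine ⟨Matrix.of fun i => (B i : Fin N → K),
    B.linearIndependent.map' C.subtype (Submodule.ker_subtype _), ?_⟩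
  change Submodule.span K (Set.range (C.subtype ∘ B)) = C
  rw [Set.range_comp, ← Submodule.map_span, B.span_eq, Submodule.map_top, Submodule.range_subtype]

lemma IsNondegenerate.eq_zero_of_forall_functionSpace (hC : IsNondegenerate F C) {x : V}
    (hx : ∀ g ∈ functionSpace β C, g x = 0) : x = 0 := by
  obtain ⟨G, hG⟩ := exists_isGeneratorMatrix C
  have hcols : ∑ j, β.equivFun x j • G.col j = 0 := by
    ext i
    have hrow : G.row i ∈ C := hG.2.le (Submodule.subset_span ⟨i, rfl⟩)
    simpa [Basis.constr_apply_fintype, Finset.sum_apply] using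
      hx _ (constr_mem_functionSpace.2 hrow)
  refine β.equivFun.map_eq_zero_iff.1 (funext ?_)
  exact Fintype.linearIndependent_iff.1 (hC _ G hG) _ hcols

lemma IsAssociatedSystem.exists_range_eq {U : Submodule F (Fin k → K)}
    (hU : IsAssociatedSystem F C U) (β : Basis (Fin N) F V) :
    ∃ T : V →ₗ[F] (Fin k → K), T.range = U ∧
      ∀ g, g ∈ functionSpace β C ↔ ∃ l : (Fin k → K) →ₗ[K] K, l.restrictScalars F ∘ₗ T = g := by
  obtain ⟨G, hG, rfl⟩ := hU
  refine ⟨β.constr F G.col, Basis.constr_range _ _, fun g => ?_⟩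
  have hcomp : ∀ a : Fin k → K, (Fintype.linearCombination K a).restrictScalars F ∘ₗ
      β.constr F G.col = β.constr K (∑ i, a i • G.row i) := fun a => β.ext fun j => by
    simp [Fintype.linearCombination_apply, Finset.sum_apply, mul_comm]
  obtain ⟨c, rfl⟩ := (β.constr K).surjective g
  rw [constr_mem_functionSpace, ← hG.2, Submodule.mem_span_range_iff_exists_fun]
  constructor
  · rintro ⟨a, rfl⟩
    exact ⟨_, hcomp a⟩
  · rintro ⟨l, hl⟩
    refine ⟨fun i => l (Pi.single i 1), (β.constr K).injective ((hcomp _).symm.trans ?_)⟩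
    rw [← hl]
    congr 2
    ext i
    simp

lemma IsNondegenerate.injective_of_functionSpace (hC : IsNondegenerate F C)
    {T : V →ₗ[F] (Fin k → K)}
    (hT : ∀ g ∈ functionSpace β C, ∃ l : (Fin k → K) →ₗ[K] K, l.restrictScalars F ∘ₗ T = g) :
    Function.Injective T := by
  rw [injective_iff_map_eq_zero]
  refine fun x hx => hC.eq_zero_of_forall_functionSpace (β := β) fun g hg => ?_
  obtain ⟨l, rfl⟩ := hT g hg
  simp [hx]

/-- The codeword `g` is the one of the linear form defining the line `W` of `q`-nondegeneracy. The
kernel of `g` being a copy of `U ∩ W`, which spans `W`, it determines `g` up to a factor. -/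
lemma IsQNondegenerate.exists_finrank_ker_eq_two (hC : IsQNondegenerate F C)
    (β : Basis (Fin N) F V) :
    ∃ g ∈ functionSpace β C, finrank F g.ker = 2 ∧
      ∀ h ∈ functionSpace β C, g.ker ≤ h.ker → ∃ a : K, a • g = h := by
  obtain ⟨hnd, U, hU, W, hW, hUW, hspan⟩ := hC
  obtain ⟨T, rfl, hT⟩ := hU.exists_range_eq β
  have hTinj : Function.Injective T := hnd.injective_of_functionSpace fun g => (hT g).1
  obtain ⟨l, rfl⟩ : ∃ l : (Fin 3 → K) →ₗ[K] K, l.ker = W := by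
    have hlt : W < ⊤ := lt_top_iff_ne_top.2 fun h => by
      rw [h, finrank_top, finrank_fin_fun] at hW
      omega
    obtain ⟨l, hl, hle⟩ := W.exists_le_ker_of_lt_top hlt
    have hker := Module.Dual.finrank_ker_add_one_of_ne_zero hl
    refine ⟨l, (Submodule.eq_of_le_of_finrank_eq hle ?_).symm⟩
    rw [finrank_fin_fun] at hker
    omega
  have hmap : Submodule.map T (l.restrictScalars F ∘ₗ T).ker =
      T.range ⊓ l.ker.restrictScalars F :=
    Submodule.map_comap_eq T (l.ker.restrictScalars F)
  have hspan' : Submodule.span K (T '' (l.restrictScalars F ∘ₗ T).ker) = l.ker := by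
    rw [← Submodule.map_coe, hmap]
    refine Submodule.eq_of_le_of_finrank_eq (Submodule.span_le.2 fun u hu => hu.2) ?_
    rw [hspan, hW]
  refine ⟨_, (hT _).2 ⟨l, rfl⟩, ?_, fun h hh hle => ?_⟩
  · rw [(Submodule.equivMapOfInjective T hTinj _).finrank_eq, hmap, hUW]
  · obtain ⟨m, rfl⟩ := (hT h).1 hh
    have hlm : l.ker ≤ m.ker := by
      rw [← hspan', Submodule.span_le]
      rintro _ ⟨x, hx, rfl⟩
      exact hle hx
    have hmem : m ∈ Submodule.span K (Set.range fun _ : Unit => l) :=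
      mem_span_of_iInf_ker_le_ker (by simpa using hlm)
    rw [Set.range_const, Submodule.mem_span_singleton] at hmem
    obtain ⟨a, rfl⟩ := hmem
    exact ⟨a, rfl⟩

end FunctionSpace

section Pencils

variable {F K : Type*} [Field F] [Field K] [Algebra F K] {n : ℕ}

/-- The pencil `D` of maps determines the code `C`: up to a matrix over `F`, the codewords of `C`
are the maps `(x, s) ↦ g x + s • z` on `K × F` with `g ∈ D` and `z : K`. The pencil of `genCode ξ f`
is the one spanned by `id` and `f`. -/
structure IsPencilOf (D : Submodule K (K →ₗ[F] K)) (C : Submodule K (Fin (n + 1) → K)) : Prop where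
  finrank_eq : finrank K D = 2
  id_mem : LinearMap.id ∈ D
  exists_basis : ∃ β : Basis (Fin (n + 1)) F (K × F),
    functionSpace β C = D.comap (LinearMap.lcomp K K (LinearMap.inl F K F))

/-- `C` is semilinearly equivalent to the codes `C_f`, for all bases. -/
def IsRepresentedBy (F : Type*) {K : Type*} [Field F] [Field K] [Algebra F K]
    (C : Submodule K (Fin (n + 1) → K)) (f : K → K) : Prop :=
  ∀ ξ : Basis (Fin n) F K, SemilinearlyEquivalent F C (genCode ξ f)

lemma mem_genCode {ξ : Fin n → K} {f : K → K} {c : Fin (n + 1) → K} :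
    c ∈ genCode ξ f ↔ ∃ a b : K, ∀ i, a * ξ i + b * f (ξ i) = c (Fin.castSucc i) := by
  rw [genCode, Submodule.mem_span_range_iff_exists_fun]
  constructor
  · rintro ⟨a, rfl⟩
    exact ⟨a 0, a 1, fun i => by simp [Fin.sum_univ_three, genMatrix, Matrix.row]⟩
  · rintro ⟨a, b, h⟩
    refine ⟨![a, b, c (Fin.last n)], funext fun j => ?_⟩
    induction j using Fin.lastCases with
    | last => simp [Fin.sum_univ_three, genMatrix, Matrix.row]
    | cast i => simp [Fin.sum_univ_three, genMatrix, Matrix.row, h]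

lemma functionSpace_genCode (ξ : Basis (Fin n) F K) (f : K →ₗ[F] K) :
    functionSpace ((ξ.prod (Basis.singleton (Fin 1) F)).reindex finSumFinEquiv) (genCode ξ f) =
      (Submodule.span K {LinearMap.id, f}).comap (LinearMap.lcomp K K (LinearMap.inl F K F)) := by
  ext g
  rw [mem_functionSpace, mem_genCode, Submodule.mem_comap, Submodule.mem_span_pair]
  refine exists₂_congr fun a b => ⟨fun h => ξ.ext fun i => ?_, fun h i => ?_⟩
  · simpa [← finSumFinEquiv_apply_left] using h i
  · simpa [← finSumFinEquiv_apply_left] using congr($h (ξ i))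

variable {C : Submodule K (Fin (n + 1) → K)} {D : Submodule K (K →ₗ[F] K)}

/-- The coordinate change `u` on `K` turns the pencil spanned by `u` and `v` into the one spanned by
`id` and `f`. -/
lemma IsPencilOf.isRepresentedBy (hD : IsPencilOf D C) [FiniteDimensional F K]
    {u v f : K →ₗ[F] K} (hu : u ∈ D) (hv : v ∈ D) (huv : LinearIndependent K ![u, v])
    (hinj : Function.Injective u) (hf : ∀ x, f (u x) = v x) : IsRepresentedBy F C f := by
  intro ξ
  obtain ⟨β, hβ⟩ := hD.exists_basis
  let e := (LinearEquiv.ofInjectiveEndo u hinj).prodCongr (LinearEquiv.refl F F)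
  have hspan (g : K →ₗ[F] K) : g ∘ₗ u ∈ D ↔ g ∈ Submodule.span K {LinearMap.id, f} := by
    obtain rfl : f ∘ₗ u = v := LinearMap.ext hf
    rw [← span_pair_eq_of_finrank_eq_two hD.finrank_eq hu hv huv, Submodule.mem_span_pair,
      Submodule.mem_span_pair]
    refine exists₂_congr fun a b => ⟨fun h => LinearMap.ext fun y => ?_, ?_⟩
    · obtain ⟨x, rfl⟩ := LinearMap.injective_iff_surjective.1 hinj y
      exact congr($h x)
    · rintro rfl
      rfl
  refine semilinearlyEquivalent_of_functionSpace_eq (β := β.map e) <|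
    (Submodule.ext fun g => ?_).trans (functionSpace_genCode ξ f).symm
  rw [mem_functionSpace_map, hβ, Submodule.mem_comap, Submodule.mem_comap, ← hspan]
  rfl

lemma exists_injective_mem [Finite K] (hD : finrank K D = 2)
    (hker : ∀ x, (∀ g ∈ D, g x = 0) → x = 0) : ∃ g ∈ D, Function.Injective g := by
  obtain ⟨g, h, rfl⟩ := exists_span_pair_eq_of_finrank_eq_two hD
  by_contra! hcon
  have hzero (m : K) : ∃ x : K, g x + m * h x = 0 ∧ x ≠ 0 := by
    have hm := hcon (g + m • h) (Submodule.mem_span_pair.2 ⟨1, m, by rw [one_smul]⟩)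
    rw [← LinearMap.ker_eq_bot, LinearMap.ker_eq_bot'.not] at hm
    push Not at hm
    exact hm
  choose X hX hX0 using hzero
  have hker' (m : K) (hm : h (X m) = 0) : X m = 0 := by
    refine hker _ fun l hl => ?_
    obtain ⟨a, b, rfl⟩ := Submodule.mem_span_pair.1 hl
    have hgm : g (X m) = 0 := by simpa [hm] using hX m
    simp [hm, hgm]
  have hXinj : Function.Injective X := by
    intro m m' hmm
    have hmul : (m - m') * h (X m) = 0 := by
      have hm' := hX m'
      rw [← hmm] at hm'
      linear_combination hX m - hm'
    exact sub_eq_zero.1 ((mul_eq_zero.1 hmul).resolve_right fun h0 => hX0 m (hker' m h0))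
  obtain ⟨m, hm⟩ := Finite.injective_iff_surjective.1 hXinj 0
  exact hX0 m hm

lemma exists_functionSpace_eq_comap [FiniteDimensional F K] (hn : finrank F K = n)
    (hC : finrank K C = 3) {c : Fin (n + 1) → K} (hc : c ∈ C) (hc1 : rankWeight F c = 1) :
    ∃ (β : Basis (Fin (n + 1)) F (K × F)) (D : Submodule K (K →ₗ[F] K)), finrank K D = 2 ∧
      functionSpace β C = D.comap (LinearMap.lcomp K K (LinearMap.inl F K F)) := by
  obtain ⟨Φ, w, hw, hΦ⟩ := exists_prod_equiv_of_finrank_range_eq_one (M := K)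
    ((finrank_range_constr (Pi.basisFun F _) c).trans hc1) (by rw [finrank_fin_fun, hn])
  let β := (Pi.basisFun F (Fin (n + 1))).map Φ.symm
  let R : (K × F →ₗ[F] K) →ₗ[K] (K →ₗ[F] K) := LinearMap.lcomp K K (LinearMap.inl F K F)
  let g : K × F →ₗ[F] K := (Pi.basisFun F _).constr K c ∘ₗ Φ.toLinearMap
  have hg (x : K) (s : F) : g (x, s) = s • w := hΦ x s
  have hgmem : g ∈ functionSpace β C := by
    refine (mem_functionSpace_map _).2 ?_
    simpa [g, LinearMap.comp_assoc] using constr_mem_functionSpace.2 hc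
  have hkerR : R.ker = Submodule.span K {g} := by
    ext h
    rw [LinearMap.mem_ker, Submodule.mem_span_singleton]
    constructor
    · intro hh
      refine ⟨h (0, 1) / w, LinearMap.prod_ext (LinearMap.ext fun x => ?_) (LinearMap.ext_ring ?_)⟩
      · simpa [hg] using (congr($hh x) : h (x, 0) = 0).symm
      · simp [hg, hw]
    · rintro ⟨a, rfl⟩
      ext x
      simp [R, hg]
  have hle : R.ker ≤ functionSpace β C := by
    rwa [hkerR, Submodule.span_singleton_le_iff_mem]
  refine ⟨β, (functionSpace β C).map R, ?_, ?_⟩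
  · have := finrank_map_add_finrank_inf_ker (functionSpace β C) R
    have hg0 : g ≠ 0 := fun h => hw (by simpa [h] using (hg 0 1).symm)
    rw [inf_eq_right.2 hle, hkerR, finrank_span_singleton hg0, finrank_functionSpace, hC] at this
    omega
  · rw [Submodule.comap_map_eq, sup_eq_left.2 hle]

lemma exists_isPencilOf [Finite K] [FiniteDimensional F K] (hn : finrank F K = n)
    (hC : finrank K C = 3) (hnd : IsNondegenerate F C) {c : Fin (n + 1) → K} (hc : c ∈ C)
    (hc1 : rankWeight F c = 1) : ∃ D, IsPencilOf (F := F) D C := by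
  obtain ⟨β, D, hD, hβ⟩ := exists_functionSpace_eq_comap hn hC hc hc1
  obtain ⟨u, hu, hinj⟩ := exists_injective_mem hD fun x hx => by
    have := hnd.eq_zero_of_forall_functionSpace (β := β) (x := (x, 0)) fun g hg => by
      rw [hβ] at hg
      exact hx _ hg
    exact congr($(this).1)
  let e := LinearEquiv.ofInjectiveEndo u hinj
  let E : (K →ₗ[F] K) ≃ₗ[K] (K →ₗ[F] K) := e.congrLeft K K
  refine ⟨D.map E.toLinearMap, (LinearEquiv.finrank_map_eq E D).trans hD, ?_, 
    β.map (e.prodCongr (LinearEquiv.refl F F)), Submodule.ext fun g => ?_⟩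
  · rw [Submodule.mem_map_equiv]
    exact hu
  · rw [mem_functionSpace_map, hβ, Submodule.mem_comap, Submodule.mem_comap,
      Submodule.mem_map_equiv]
    rfl

end Pencils

section BlockingSet

variable {F K V : Type*} [Field F] [Field K] [Algebra F K] [AddCommGroup V] [Module K V]
  [Module F V] [IsScalarTower F K V]

omit [Algebra F K] [Module F V] [IsScalarTower F K V] in
lemma mk_mem_pointsOf {W : Submodule K V} {u : V} (hu : u ≠ 0) :
    Projectivization.mk K u hu ∈ pointsOf W ↔ u ∈ W := by
  rw [pointsOf, Set.mem_ofPred_eq, Projectivization.submodule_mk,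
    Submodule.span_singleton_le_iff_mem]

lemma isBlockingSet_linearSet [FiniteDimensional F K] (hV : finrank K V = 3) {U : Submodule F V}
    (hU : finrank F K < finrank F U) : IsBlockingSet (linearSet K U) := by
  intro W hW
  have := FiniteDimensional.of_finrank_pos (hV ▸ three_pos : 0 < finrank K V)
  have := FiniteDimensional.trans F K V
  have hWF : finrank F (W.restrictScalars F) = finrank F K * 2 := by
    rw [← hW]
    exact (finrank_mul_finrank F K W).symm
  have hne : U ⊓ W.restrictScalars F ≠ ⊥ := by
    intro h
    have hsum := Submodule.finrank_sup_add_finrank_inf_eq U (W.restrictScalars F)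
    have hle := Submodule.finrank_le (U ⊔ W.restrictScalars F)
    rw [h, finrank_bot] at hsum
    rw [← finrank_mul_finrank F K V, hV] at hle
    omega
  obtain ⟨u, ⟨huU, huW⟩, hu⟩ := Submodule.exists_mem_ne_zero_of_ne_bot hne
  exact ⟨Projectivization.mk K u hu, ⟨u, hu, huU, rfl⟩, (mk_mem_pointsOf hu).2 huW⟩

lemma ncard_linearSet_inter_pointsOf_lt (U : Submodule F V) (W : Submodule K V)
    [Finite (U ⊓ W.restrictScalars F : Submodule F V)] :
    (linearSet K U ∩ pointsOf W).ncard <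
      Nat.card (U ⊓ W.restrictScalars F : Submodule F V) := by
  have hrange : linearSet K U ∩ pointsOf W = Set.range
      (fun w : {w : (U ⊓ W.restrictScalars F : Submodule F V) // w ≠ 0} =>
        Projectivization.mk K (w.1 : V) (by simpa using w.2)) := by
    ext p
    constructor
    · rintro ⟨⟨u, hu, huU, rfl⟩, hp⟩
      rw [mk_mem_pointsOf] at hp
      exact ⟨⟨⟨u, huU, hp⟩, fun h => hu congr($h)⟩, rfl⟩
    · rintro ⟨w, rfl⟩
      exact ⟨⟨_, _, w.1.2.1, rfl⟩, (mk_mem_pointsOf _).2 w.1.2.2⟩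
  rw [hrange, ← Nat.card_coe_set_eq]
  exact (Finite.card_range_le _).trans_lt (Finite.card_subtype_lt (x := 0) (by simp))

lemma ncard_linearSet_diff_pointsOf {U : Submodule F V} {W : Submodule K V} {v : V} (hv : v ∉ W)
    (hU : U = (U ⊓ W.restrictScalars F) ⊔ Submodule.span F {v}) :
    (linearSet K U \ pointsOf W).ncard = Nat.card (U ⊓ W.restrictScalars F : Submodule F V) := by
  have hvU : v ∈ U := by
    rw [hU]
    exact Submodule.mem_sup_right (Submodule.mem_span_singleton_self v)
  have hnmem (w : (U ⊓ W.restrictScalars F : Submodule F V)) : (w : V) + v ∉ W :=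
    fun h => hv ((Submodule.add_mem_iff_right W w.2.2).1 h)
  let point (w : (U ⊓ W.restrictScalars F : Submodule F V)) : ℙ K V :=
    Projectivization.mk K (w + v) fun h => hnmem w (h ▸ W.zero_mem)
  have hrange : linearSet K U \ pointsOf W = Set.range point := by
    ext p
    constructor
    · rintro ⟨⟨u, hu, huU, rfl⟩, hp⟩
      rw [mk_mem_pointsOf] at hp
      rw [hU, Submodule.mem_sup] at huU
      obtain ⟨w, hw, _, hs, rfl⟩ := huU
      obtain ⟨s, rfl⟩ := Submodule.mem_span_singleton.1 hs
      have hs0 : s ≠ 0 := by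
        rintro rfl
        exact hp (by simpa using hw.2)
      refine ⟨⟨s⁻¹ • w, Submodule.smul_mem _ _ hw⟩, ?_⟩
      refine (Projectivization.mk_eq_mk_iff' _ _ _ _ _).2 ⟨algebraMap F K s⁻¹, ?_⟩
      rw [algebraMap_smul, smul_add, inv_smul_smul₀ hs0]
    · rintro ⟨w, rfl⟩
      exact ⟨⟨_, _, U.add_mem w.2.1 hvU, rfl⟩, fun h => hnmem w ((mk_mem_pointsOf _).1 h)⟩
  have hinj : Function.Injective point := by
    intro w w' h
    obtain ⟨a, ha⟩ := (Projectivization.mk_eq_mk_iff' _ _ _ _ _).1 h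
    have hmem : (a - 1) • v ∈ W := by
      have : (a - 1) • v = (w : V) - a • (w' : V) := by
        rw [sub_smul, one_smul, sub_eq_sub_iff_add_eq_add, add_comm, ← smul_add, ha]
      rw [this]
      exact W.sub_mem w.2.2 (W.smul_mem a w'.2.2)
    obtain rfl : a = 1 := by
      by_contra ha1
      exact hv ((W.smul_mem_iff (sub_ne_zero.2 ha1)).1 hmem)
    rw [one_smul] at ha
    exact Subtype.ext (add_right_cancel ha).symm
  rw [hrange, ← Nat.card_coe_set_eq, Nat.card_range_of_injective hinj]

omit [Module K V] [IsScalarTower F K V] in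
lemma exists_eq_inf_ker_sup_span_of_finrank_map_eq_one {V' : Type*} [AddCommGroup V'] [Module F V']
    {U : Submodule F V} {g : V →ₗ[F] V'} (hg : finrank F (U.map g) = 1) :
    ∃ v ∈ U, g v ≠ 0 ∧ U = (U ⊓ g.ker) ⊔ Submodule.span F {v} := by
  obtain ⟨⟨_, v, hvU, rfl⟩, hv, hspan⟩ := finrank_eq_one_iff'.1 hg
  refine ⟨v, hvU, fun h => hv (Subtype.ext h), le_antisymm (fun u hu => ?_)
    (sup_le inf_le_left ((Submodule.span_singleton_le_iff_mem _ _).2 hvU))⟩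
  obtain ⟨s, hs⟩ := hspan ⟨g u, u, hu, rfl⟩
  have hs' : s • g v = g u := congr($hs)
  rw [← sub_add_cancel u (s • v)]
  refine Submodule.add_mem_sup ⟨U.sub_mem hu (U.smul_mem _ hvU), ?_⟩
    (Submodule.smul_mem _ _ (Submodule.mem_span_singleton_self v))
  rw [SetLike.mem_coe, LinearMap.mem_ker, map_sub, map_smul, hs', sub_self]

lemma isLinearRedeiBlockingSet_of_finrank_map_eq_one [Finite K] [FiniteDimensional F K]
    {U : Submodule F (Fin 3 → K)} (hU : finrank F U = finrank F K + 1) {l : (Fin 3 → K) →ₗ[K] K}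
    (hl : finrank F (U.map (l.restrictScalars F)) = 1) : IsLinearRedeiBlockingSet U := by
  obtain ⟨v, -, hv, hUv⟩ := exists_eq_inf_ker_sup_span_of_finrank_map_eq_one hl
  rw [LinearMap.ker_restrictScalars] at hUv
  have hvker : v ∉ l.ker := hv
  have hl0 : l ≠ 0 := by
    rintro rfl
    exact hv rfl
  have hker : finrank K l.ker = 2 := by
    have := Module.Dual.finrank_ker_add_one_of_ne_zero hl0
    rw [finrank_fin_fun] at this
    omega
  have hrank : finrank F (U ⊓ l.ker.restrictScalars F : Submodule F (Fin 3 → K)) =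
      finrank F K := by
    have := finrank_map_add_finrank_inf_ker U (l.restrictScalars F)
    rw [LinearMap.ker_restrictScalars] at this
    omega
  have hcard : Nat.card (U ⊓ l.ker.restrictScalars F : Submodule F (Fin 3 → K)) = Nat.card K :=
    Nat.card_congr (LinearEquiv.ofFinrankEq _ _ hrank).toEquiv
  refine ⟨hU, isBlockingSet_linearSet (finrank_fin_fun K) (by omega), l.ker,
    ⟨hker, _, ?_, ?_, rfl⟩, hrank, v, hvker, hUv⟩
  · exact hcard ▸ ncard_linearSet_inter_pointsOf_lt U l.ker
  · rw [← Set.ncard_inter_add_ncard_sdiff_eq_ncard _ (pointsOf l.ker) (Set.toFinite _), add_comm,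
      ncard_linearSet_diff_pointsOf hvker hUv, hcard]

lemma isLinearRedeiBlockingSet [Finite K] [FiniteDimensional F K] {n : ℕ} (hn : finrank F K = n)
    {C : Submodule K (Fin (n + 1) → K)} (hnd : IsNondegenerate F C) {c : Fin (n + 1) → K}
    (hc : c ∈ C) (hc1 : rankWeight F c = 1) {U : Submodule F (Fin 3 → K)}
    (hU : IsAssociatedSystem F C U) : IsLinearRedeiBlockingSet U := by
  obtain ⟨T, rfl, hT⟩ := hU.exists_range_eq (Pi.basisFun F (Fin (n + 1)))
  have hTinj : Function.Injective T := hnd.injective_of_functionSpace fun g => (hT g).1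
  obtain ⟨l, hl⟩ := (hT _).1 (constr_mem_functionSpace.2 hc)
  refine isLinearRedeiBlockingSet_of_finrank_map_eq_one (l := l) ?_ ?_
  · rw [LinearMap.finrank_range_of_inj hTinj, finrank_fin_fun, hn]
  · rw [← LinearMap.range_comp, hl, finrank_range_constr, hc1]

end BlockingSet

section Counting

variable {F K : Type*} [Field F] [Field K] [Algebra F K] {n : ℕ}

/-- The weight of the codeword `(x, s) ↦ g x + s • z`, encoded by the pair `(g, z)`. -/
noncomputable def pairWeight (p : (K →ₗ[F] K) × K) : ℕ :=
  finrank F (p.1.range ⊔ Submodule.span F {p.2} : Submodule F K)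

lemma pairWeight_of_mem {g : K →ₗ[F] K} {z : K} (hz : z ∈ g.range) :
    pairWeight (g, z) = finrank F g.range := by
  rw [pairWeight, sup_eq_left.2 ((Submodule.span_singleton_le_iff_mem _ _).2 hz)]

lemma pairWeight_zero_right (g : K →ₗ[F] K) : pairWeight (g, 0) = finrank F g.range :=
  pairWeight_of_mem g.range.zero_mem

lemma pairWeight_zero_left {z : K} (hz : z ≠ 0) : pairWeight ((0 : K →ₗ[F] K), z) = 1 := by
  rw [pairWeight, LinearMap.range_zero, bot_sup_eq, finrank_span_singleton hz]

lemma pairWeight_smul {k : K} (hk : k ≠ 0) (p : (K →ₗ[F] K) × K) :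
    pairWeight (k • p) = pairWeight p := by
  have hmap : (k • p).1.range ⊔ Submodule.span F {(k • p).2} =
      (p.1.range ⊔ Submodule.span F {p.2}).map (LinearMap.mulLeft F k) := by
    rw [Submodule.map_sup, Submodule.map_span, Set.image_singleton, ← LinearMap.range_comp]
    rfl
  rw [pairWeight, hmap]
  exact (Submodule.equivMapOfInjective _ (mul_right_injective₀ hk) _).finrank_eq.symm

lemma IsPencilOf.numCodewords_eq {C : Submodule K (Fin (n + 1) → K)}
    {D : Submodule K (K →ₗ[F] K)} (hD : IsPencilOf D C) (P : ℕ → Prop) :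
    numCodewords F C P = {p : (K →ₗ[F] K) × K | p.1 ∈ D ∧ P (pairWeight p)}.ncard := by
  obtain ⟨β, hβ⟩ := hD.exists_basis
  let toMap (p : (K →ₗ[F] K) × K) : K × F →ₗ[F] K := p.1.coprod (.toSpanSingleton F K p.2)
  have hinj : Function.Injective toMap := by
    intro p p' h
    refine Prod.ext (LinearMap.ext fun x => ?_) ?_
    · simpa [toMap] using congr($h (x, 0))
    · simpa [toMap] using congr($h (0, 1))
  have hsurj (g : K × F →ₗ[F] K) :
      toMap (LinearMap.lcomp K K (LinearMap.inl F K F) g, g (0, 1)) = g :=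
    LinearMap.prod_ext (by ext; simp [toMap]) (by ext; simp [toMap])
  have hweight (p : (K →ₗ[F] K) × K) : finrank F (toMap p).range = pairWeight p := by
    rw [LinearMap.range_coprod, LinearMap.range_toSpanSingleton, pairWeight]
  rw [numCodewords_eq_ncard_functionSpace β, hβ, ← Set.ncard_image_of_injective _ hinj]
  congr 1
  ext g
  constructor
  · rintro ⟨hg, hP⟩
    exact ⟨_, ⟨Submodule.mem_comap.1 hg, by rwa [← hweight, hsurj]⟩, hsurj g⟩
  · rintro ⟨p, ⟨hp, hP⟩, rfl⟩
    refine ⟨?_, by rwa [hweight]⟩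
    rw [Submodule.mem_comap]
    convert hp
    ext x
    simp [toMap]

lemma mul_ncard_add_one_le_ncard {V : Type*} [AddCommGroup V] [Module K V] [Finite K] [Finite V]
    {T : Set (V × K)} {S : Set K} {g h : V} {z : K} (hg : g ≠ 0) (hh : h ∉ Submodule.span K {g})
    (hS : ∀ k : K, k ≠ 0 → ∀ w ∈ S, k • (g, w) ∈ T) (hT : (h, z) ∈ T) :
    (Nat.card K - 1) * S.ncard + 1 ≤ T.ncard := by
  let scale (p : K × K) : V × K := p.1 • (g, p.2)
  have hinj : Set.InjOn scale ({0}ᶜ ×ˢ S) := by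
    rintro ⟨k, w⟩ ⟨hk, -⟩ ⟨k', w'⟩ - heq
    obtain rfl : k = k' := smul_left_injective K hg congr($heq.1)
    exact congr((k, $(mul_left_cancel₀ hk congr($heq.2))))
  have hnmem : (h, z) ∉ scale '' ({0}ᶜ ×ˢ S) := by
    rintro ⟨⟨k, w⟩, -, heq⟩
    exact hh (Submodule.mem_span_singleton.2 ⟨k, congr($heq.1)⟩)
  have hsub : insert (h, z) (scale '' ({0}ᶜ ×ˢ S)) ⊆ T := by
    refine Set.insert_subset hT ?_
    rintro _ ⟨⟨k, w⟩, ⟨hk, hw⟩, rfl⟩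
    exact hS k hk w hw
  have := Set.ncard_le_ncard hsub (Set.toFinite _)
  rwa [Set.ncard_insert_of_notMem hnmem (Set.toFinite _), hinj.ncard_image, Set.ncard_prod,
    Set.ncard_compl, Set.ncard_singleton] at this

lemma finrank_range_le_pairWeight [FiniteDimensional F K] (p : (K →ₗ[F] K) × K) :
    finrank F p.1.range ≤ pairWeight p :=
  Submodule.finrank_mono le_sup_left

lemma ncard_range_eq_pow_finrank [Finite K] (g : K →ₗ[F] K) :
    (g.range : Set K).ncard = Nat.card F ^ finrank F g.range :=
  Module.natCard_eq_pow_finrank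

lemma ne_zero_of_finrank_range_eq_two {g : K →ₗ[F] K} (hg2 : finrank F g.range = 2) : g ≠ 0 := by
  rintro rfl
  rw [LinearMap.range_zero, finrank_bot] at hg2
  omega

variable {C : Submodule K (Fin (n + 1) → K)} {D : Submodule K (K →ₗ[F] K)}

lemma ncard_zero_prod_compl [Finite K] : ((fun z : K => ((0 : K →ₗ[F] K), z)) '' {0}ᶜ).ncard =
    Nat.card K - 1 := by
  rw [Set.ncard_image_of_injective _ (Prod.mk_right_injective _), Set.ncard_compl,
    Set.ncard_singleton]

lemma IsPencilOf.exists_finrank_range_eq_one [Finite K] [FiniteDimensional F K]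
    (hD : IsPencilOf D C) (h : Nat.card K - 1 < numCodewords F C (fun w => w = 1)) :
    ∃ g ∈ D, finrank F g.range = 1 := by
  rw [hD.numCodewords_eq, ← ncard_zero_prod_compl (F := F)] at h
  obtain ⟨⟨g, z⟩, ⟨hg, hgz⟩, hnmem⟩ := Set.exists_mem_notMem_of_ncard_lt_ncard h
  refine ⟨g, hg, le_antisymm (hgz ▸ finrank_range_le_pairWeight (g, z)) ?_⟩
  by_contra! hlt
  obtain rfl : g = 0 := by
    rwa [Nat.lt_one_iff, Submodule.finrank_eq_zero, LinearMap.range_eq_bot] at hlt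
  refine hnmem ⟨z, ?_, rfl⟩
  rintro rfl
  rw [pairWeight_zero_right, LinearMap.range_zero, finrank_bot] at hgz
  omega

lemma IsPencilOf.finrank_range_ne_one [Finite K] (hD : IsPencilOf D C)
    (h : numCodewords F C (fun w => w = 1) = Nat.card K - 1) {g : K →ₗ[F] K} (hg : g ∈ D) :
    finrank F g.range ≠ 1 := by
  intro hg1
  have : Finite (K →ₗ[F] K) := DFunLike.finite _
  rw [hD.numCodewords_eq, ← ncard_zero_prod_compl (F := F)] at h
  have hsub : (fun z : K => ((0 : K →ₗ[F] K), z)) '' {0}ᶜ ⊆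
      {p | p.1 ∈ D ∧ pairWeight p = 1} := by
    rintro _ ⟨z, hz, rfl⟩
    exact ⟨D.zero_mem, pairWeight_zero_left hz⟩
  have hmem : (g, (0 : K)) ∈ {p : (K →ₗ[F] K) × K | p.1 ∈ D ∧ pairWeight p = 1} :=
    ⟨hg, (pairWeight_zero_right g).trans hg1⟩
  rw [← Set.eq_of_subset_of_ncard_le hsub h.le (Set.toFinite _)] at hmem
  obtain ⟨z, hz, heq⟩ := hmem
  exact hz congr($heq.2)

lemma IsPencilOf.exists_finrank_range_eq_two [FiniteDimensional F K] (hD : IsPencilOf D C)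
    (hone : ∀ g ∈ D, finrank F g.range ≠ 1) (h : numCodewords F C (fun w => w = 2) ≠ 0) :
    ∃ g ∈ D, finrank F g.range = 2 := by
  rw [hD.numCodewords_eq] at h
  obtain ⟨⟨g, z⟩, hg, hgz⟩ := Set.nonempty_of_ncard_ne_zero h
  refine ⟨g, hg, le_antisymm (hgz ▸ finrank_range_le_pairWeight (g, z)) ?_⟩
  have hne := hone g hg
  by_contra! hlt
  obtain rfl : g = 0 := by
    rw [← LinearMap.range_eq_bot, ← Submodule.finrank_eq_zero (R := F)]
    omega
  have : pairWeight ((0 : K →ₗ[F] K), z) ≤ 1 := by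
    rw [pairWeight, LinearMap.range_zero, bot_sup_eq]
    exact (finrank_span_le_card {z}).trans (by simp)
  omega

variable {g h : K →ₗ[F] K}

lemma IsPencilOf.finrank_range_ne_two [Finite K] (hD : IsPencilOf D C)
    (hnum : numCodewords F C (fun w => w = 2) ≤ (Nat.card K - 1) * Nat.card F ^ 2)
    (hg : g ∈ D) (hg2 : finrank F g.range = 2) (hh : h ∈ D) (hgh : h ∉ Submodule.span K {g}) :
    finrank F h.range ≠ 2 := by
  intro hh2
  have : Finite (K →ₗ[F] K) := DFunLike.finite _
  have hcount := mul_ncard_add_one_le_ncard (T := {p | p.1 ∈ D ∧ pairWeight p = 2})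
    (S := (g.range : Set K)) (ne_zero_of_finrank_range_eq_two hg2) hgh
    (fun k hk w hw => ⟨D.smul_mem k hg, ?_⟩) ⟨hh, (pairWeight_zero_right h).trans hh2⟩
  · rw [← hD.numCodewords_eq (fun w => w = 2), ncard_range_eq_pow_finrank, hg2] at hcount
    omega
  · rw [pairWeight_smul hk, pairWeight_of_mem hw, hg2]

lemma IsPencilOf.le_finrank_range [Finite K] (hD : IsPencilOf D C) {m : ℕ}
    (hnum : numCodewords F C (fun w => 3 ≤ w ∧ w < m) ≤
      (Nat.card K - 1) * (Nat.card K - Nat.card F ^ 2))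
    (hg : g ∈ D) (hg2 : finrank F g.range = 2) (hh : h ∈ D) (hgh : h ∉ Submodule.span K {g})
    (hh3 : 3 ≤ finrank F h.range) : m ≤ finrank F h.range := by
  by_contra! hlt
  have : Finite (K →ₗ[F] K) := DFunLike.finite _
  have hcount := mul_ncard_add_one_le_ncard
    (T := {p | p.1 ∈ D ∧ 3 ≤ pairWeight p ∧ pairWeight p < m})
    (S := (g.range : Set K)ᶜ) (ne_zero_of_finrank_range_eq_two hg2) hgh
    (fun k hk w hw => ⟨D.smul_mem k hg, ?_⟩)
    ⟨hh, by rwa [pairWeight_zero_right], by rwa [pairWeight_zero_right]⟩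
  · rw [← hD.numCodewords_eq (fun w => 3 ≤ w ∧ w < m), Set.ncard_compl,
      ncard_range_eq_pow_finrank, hg2] at hcount
    omega
  · rw [pairWeight_smul hk, pairWeight, Submodule.finrank_sup_span_singleton hw, hg2]
    exact ⟨le_rfl, hh3.trans_lt hlt⟩

lemma IsPencilOf.exists_finrank_range_eq_two_and_le [Finite K] [FiniteDimensional F K]
    (hD : IsPencilOf D C) {m : ℕ}
    (h1 : numCodewords F C (fun w => w = 1) = Nat.card K - 1)
    (h2 : numCodewords F C (fun w => w = 2) = (Nat.card K - 1) * Nat.card F ^ 2)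
    (h3 : numCodewords F C (fun w => 3 ≤ w ∧ w < m) ≤
      (Nat.card K - 1) * (Nat.card K - Nat.card F ^ 2)) :
    ∃ g ∈ D, finrank F g.range = 2 ∧
      ∀ h ∈ D, h ∉ Submodule.span K {g} → m ≤ finrank F h.range := by
  have : Finite F := .of_injective _ (algebraMap F K).injective
  have hone : ∀ g ∈ D, finrank F g.range ≠ 1 := fun g => hD.finrank_range_ne_one h1
  have hK : 1 < Nat.card K := Finite.one_lt_card
  obtain ⟨g, hg, hg2⟩ := hD.exists_finrank_range_eq_two hone <| by
    rw [h2]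
    exact (Nat.mul_pos (by omega) (pow_pos Nat.card_pos 2)).ne'
  refine ⟨g, hg, hg2, fun h hh hgh => hD.le_finrank_range h3 hg hg2 hh hgh ?_⟩
  have hne0 : finrank F h.range ≠ 0 := fun h0 => by
    rw [Submodule.finrank_eq_zero, LinearMap.range_eq_bot] at h0
    exact hgh (h0 ▸ Submodule.zero_mem _)
  have hne1 := hone h hh
  have hne2 := hD.finrank_range_ne_two h2.le hg hg2 hh hgh
  omega

end Counting

section PointOfWeightOne

variable {F K : Type*} [Field F] [Field K] [Algebra F K] {n : ℕ}

lemma finrank_ker_le_finrank_ker_comp_inl_add_one [FiniteDimensional F K]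
    (g : K × F →ₗ[F] K) :
    finrank F g.ker ≤ finrank F (g ∘ₗ LinearMap.inl F K F).ker + 1 := by
  have hsum := finrank_map_add_finrank_inf_ker g.ker (LinearMap.snd F K F)
  have hsnd : finrank F (g.ker.map (LinearMap.snd F K F)) ≤ 1 :=
    (Submodule.finrank_le _).trans_eq (finrank_self F)
  have hinf : g.ker ⊓ (LinearMap.snd F K F).ker ≤
      (g ∘ₗ LinearMap.inl F K F).ker.map (LinearMap.inl F K F) := by
    rintro ⟨x, s⟩ ⟨hx, rfl : s = 0⟩
    exact ⟨x, hx, rfl⟩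
  have hle := (Submodule.finrank_mono hinf).trans (Submodule.finrank_map_le _ _)
  omega

lemma map_inl_ker_comp_inl_le (g : K × F →ₗ[F] K) :
    (g ∘ₗ LinearMap.inl F K F).ker.map (LinearMap.inl F K F) ≤ g.ker := by
  rintro _ ⟨x, hx, rfl⟩
  exact hx

lemma IsPencilOf.exists_finrank_ker_eq_one {C : Submodule K (Fin (n + 1) → K)}
    {D : Submodule K (K →ₗ[F] K)} (hD : IsPencilOf D C) [FiniteDimensional F K]
    (hC : IsQNondegenerate F C) (hK : 2 < finrank F K) :
    ∃ h ∈ D, finrank F h.ker = 1 := by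
  obtain ⟨β, hβ⟩ := hD.exists_basis
  obtain ⟨g, hg, hg2, hdet⟩ := hC.exists_finrank_ker_eq_two β
  rw [hβ] at hg hdet
  have hle := map_inl_ker_comp_inl_le g
  refine ⟨g ∘ₗ LinearMap.inl F K F, hg, ?_⟩
  have hmap : finrank F ((g ∘ₗ LinearMap.inl F K F).ker.map (LinearMap.inl F K F)) =
      finrank F (g ∘ₗ LinearMap.inl F K F).ker :=
    (Submodule.equivMapOfInjective _ LinearMap.inl_injective _).finrank_eq.symm
  have hge := finrank_ker_le_finrank_ker_comp_inl_add_one g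
  have hne2 : finrank F (g ∘ₗ LinearMap.inl F K F).ker ≠ 2 := by
    intro h2
    have hker := Submodule.eq_of_le_of_finrank_eq hle (by rw [hmap, h2, hg2])
    obtain ⟨a, ha⟩ := hdet (.toSpanSingleton F K 1 ∘ₗ .snd F K F)
      (by
        rw [Submodule.mem_comap]
        convert D.zero_mem
        ext
        simp)
      (by
        rw [← hker]
        rintro _ ⟨x, -, rfl⟩
        simp)
    have ha0 : a ≠ 0 := by
      rintro rfl
      simpa using congr($ha (0, 1))
    have hzero : g ∘ₗ LinearMap.inl F K F = 0 := by
      ext x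
      simpa [ha0] using congr($ha (x, 0))
    rw [hzero, LinearMap.ker_zero, finrank_top] at h2
    omega
  have := Submodule.finrank_mono hle
  omega

end PointOfWeightOne

section TraceForms

variable {F K : Type*} [Field F] [Field K] [Algebra F K]

/-- The trace from `K` to `F` as an `F`-linear endomorphism of `K`. -/
noncomputable def traceMap (F K : Type*) [Field F] [Field K] [Algebra F K] : K →ₗ[F] K :=
  Algebra.linearMap F K ∘ₗ Algebra.trace F K

lemma traceMap_apply (x : K) : traceMap F K x = Tr F x := rfl

lemma Tr_mul (x y : K) : Tr F x * y = Algebra.trace F K x • y := (Algebra.smul_def _ _).symm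

lemma linearIndependent_smul_pair {k V : Type*} [Field k] [AddCommGroup V] [Module k V] {a b : k}
    (ha : a ≠ 0) (hb : b ≠ 0) {u v : V} (huv : LinearIndependent k ![u, v]) :
    LinearIndependent k ![a • u, b • v] := by
  simpa using (LinearIndependent.pair_add_smul_add_smul_iff a 0 0 b).2 ⟨huv, by simp [ha, hb]⟩

lemma linearIndependent_id_of_apply_eq_zero {g : K →ₗ[F] K} (hg : g ≠ 0) {x : K} (hx : x ≠ 0)
    (hgx : g x = 0) : LinearIndependent K ![LinearMap.id, g] := by
  refine (LinearIndependent.pair_iff' fun h => hx (LinearMap.congr_fun h x)).2 fun a ha => hg ?_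
  have hax : a * x = 0 := by simpa [hgx] using congr($ha x)
  rw [← ha, (mul_eq_zero.1 hax).resolve_right hx, zero_smul]

lemma exists_ne_zero_apply_eq_zero [FiniteDimensional F K] {g : K →ₗ[F] K}
    (hg : finrank F g.range < finrank F K) : ∃ x ≠ 0, g x = 0 := by
  have hker : g.ker ≠ ⊥ := by
    rintro hker
    have := g.finrank_range_add_finrank_ker
    rw [hker, finrank_bot] at this
    omega
  obtain ⟨x, hgx, hx⟩ := Submodule.exists_mem_ne_zero_of_ne_bot hker
  exact ⟨x, hx, hgx⟩

lemma map_mulLeft_span_pair (a u v : K) :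
    (Submodule.span F {u, v}).map (LinearMap.mulLeft F a) = Submodule.span F {a * u, a * v} := by
  rw [Submodule.map_span, Set.image_pair, LinearMap.mulLeft_apply, LinearMap.mulLeft_apply]

lemma finrank_map_mulLeft {a : K} (ha : a ≠ 0) (S : Submodule F K) :
    finrank F (S.map (LinearMap.mulLeft F a)) = finrank F S :=
  (Submodule.equivMapOfInjective _ (mul_right_injective₀ ha) S).finrank_eq.symm

lemma exists_map_mulLeft_eq_span_one {S : Submodule F K} (hS : finrank F S = 2) :
    ∃ a b : K, a ≠ 0 ∧ LinearIndependent F ![1, b] ∧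
      S.map (LinearMap.mulLeft F a) = Submodule.span F {1, b} := by
  obtain ⟨u, v, rfl⟩ := exists_span_pair_eq_of_finrank_eq_two hS
  have hu : u ≠ 0 := (linearIndependent_pair_iff_finrank_span.2 hS).ne_zero 0
  have hmap : (Submodule.span F {u, v}).map (LinearMap.mulLeft F u⁻¹) =
      Submodule.span F {1, u⁻¹ * v} := by
    rw [map_mulLeft_span_pair, inv_mul_cancel₀ hu]
  refine ⟨u⁻¹, u⁻¹ * v, inv_ne_zero hu, linearIndependent_pair_iff_finrank_span.2 ?_, hmap⟩
  rw [← hmap, finrank_map_mulLeft (inv_ne_zero hu), hS]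

section Separable

variable [FiniteDimensional F K] [Algebra.IsSeparable F K]

lemma exists_eq_trace_mul (g : K →ₗ[F] F) : ∃ ξ : K, ∀ x, g x = Algebra.trace F K (ξ * x) := by
  refine ⟨((Algebra.traceForm F K).toDual (traceForm_nondegenerate F K)).symm g, fun x => ?_⟩
  rw [← Algebra.traceForm_apply, LinearMap.BilinForm.apply_toDual_symm_apply]

lemma exists_eq_sum_Tr_mul {ι : Type*} [Fintype ι] {v : ι → K} (hv : LinearIndependent F v)
    {g : K →ₗ[F] K} (hg : g.range ≤ Submodule.span F (Set.range v)) :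
    ∃ ξ : ι → K, ∀ x, g x = ∑ i, Tr F (ξ i * x) * v i := by
  let g' := g.codRestrict _ fun x => hg (g.mem_range_self x)
  choose ξ hξ using fun i => exists_eq_trace_mul ((Basis.span hv).coord i ∘ₗ g')
  refine ⟨ξ, fun x => ?_⟩
  have hsum := congrArg Subtype.val ((Basis.span hv).sum_repr (g' x))
  rw [AddSubmonoidClass.coe_finsetSum] at hsum
  refine hsum.symm.trans (Finset.sum_congr rfl fun i _ => ?_)
  rw [Tr_mul, ← hξ, Submodule.coe_smul, Basis.span_apply]
  rfl

variable {n : ℕ} {C : Submodule K (Fin (n + 1) → K)} {D : Submodule K (K →ₗ[F] K)} {g : K →ₗ[F] K}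

lemma IsPencilOf.isRepresentedBy_traceMap (hD : IsPencilOf D C) (hn : 2 ≤ finrank F K)
    (hg : g ∈ D) (hg1 : finrank F g.range = 1) : IsRepresentedBy F C (traceMap F K) := by
  obtain ⟨⟨α, hα⟩, hα0, -⟩ := finrank_eq_one_iff'.1 hg1
  replace hα0 : α ≠ 0 := fun h => hα0 (Subtype.ext h)
  have hrange : g.range = Submodule.span F (Set.range ![α]) := by
    rw [Matrix.range_cons_empty]
    refine (Submodule.eq_of_le_of_finrank_eq ?_ ?_).symm
    · rwa [Submodule.span_singleton_le_iff_mem]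
    · rw [finrank_span_singleton hα0, hg1]
  have hα1 : LinearIndependent F ![α] := LinearIndependent.of_subsingleton 0 hα0
  obtain ⟨ξ, hξ⟩ := exists_eq_sum_Tr_mul hα1 hrange.le
  simp only [Fin.sum_univ_one, Matrix.cons_val_fin_one] at hξ
  obtain ⟨y, hy⟩ := hα
  have hξ0 : ξ 0 ≠ 0 := fun h => hα0 <| by
    rw [← hy, hξ, h, zero_mul, Tr, map_zero, map_zero, zero_mul]
  obtain ⟨x, hx, hgx⟩ := exists_ne_zero_apply_eq_zero (hg1.trans_lt hn)
  have hg0 : g ≠ 0 := by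
    rintro rfl
    exact hα0 hy.symm
  have hli : LinearIndependent K ![ξ 0 • LinearMap.id, α⁻¹ • g] :=
    linearIndependent_smul_pair hξ0 (inv_ne_zero hα0)
      (linearIndependent_id_of_apply_eq_zero hg0 hx hgx)
  refine hD.isRepresentedBy (D.smul_mem _ hD.id_mem) (D.smul_mem _ hg) hli
    (mul_right_injective₀ hξ0) fun x => ?_
  rw [LinearMap.smul_apply _ g, smul_eq_mul, hξ, mul_comm, mul_inv_cancel_right₀ hα0]
  rfl

lemma exists_eq_Tr_add_mul_Tr {b : K} (hb : LinearIndependent F ![1, b])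
    (hg : g.range = Submodule.span F {1, b}) :
    ∃ ξ η : K, ∀ x, g x = Tr F (ξ * x) + b * Tr F (η * x) := by
  obtain ⟨ξ, hξ⟩ := exists_eq_sum_Tr_mul hb (g := g) (by rw [hg, Matrix.range_cons_cons_empty])
  refine ⟨ξ 0, ξ 1, fun x => ?_⟩
  rw [hξ, Fin.sum_univ_two, mul_comm b]
  simp

end Separable

end TraceForms

section Clubs

variable {F K : Type*} [Field F] [Field K] [Algebra F K] {f : K →ₗ[F] K} {b : K}

lemma notMem_range_of_linearIndependent (hb : LinearIndependent F ![1, b]) :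
    b ∉ Set.range (algebraMap F K) := by
  rintro ⟨s, rfl⟩
  exact one_ne_zero (LinearIndependent.pair_iff.1 hb (-s) 1 (by simp [Algebra.smul_def])).2

lemma Tr_add_mul_Tr_eq_zero_iff (hb : LinearIndependent F ![1, b]) {x y : K} :
    Tr F x + b * Tr F y = 0 ↔ Algebra.trace F K x = 0 ∧ Algebra.trace F K y = 0 := by
  constructor
  · intro h
    refine LinearIndependent.pair_iff.1 hb _ _ ?_
    rw [← h, ← Tr_mul, ← Tr_mul, mul_one, mul_comm b]
  · rintro ⟨hx, hy⟩
    simp [Tr, hx, hy]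

lemma forall_mem_span_pair_trace_mul {ξ η x : K} :
    (∀ y ∈ Submodule.span F {ξ, η}, Algebra.trace F K (y * x) = 0) ↔
      Algebra.trace F K (ξ * x) = 0 ∧ Algebra.trace F K (η * x) = 0 := by
  constructor
  · intro h
    exact ⟨h _ (Submodule.subset_span (by simp)), h _ (Submodule.subset_span (by simp))⟩
  · rintro ⟨hξ, hη⟩ y hy
    obtain ⟨s, t, rfl⟩ := Submodule.mem_span_pair.1 hy
    rw [add_mul, smul_mul_assoc, smul_mul_assoc, map_add, map_smul, map_smul, hξ, hη, smul_zero,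
      smul_zero, add_zero]

/-- All points of `L_f` other than `⟨(1, 0)⟩` have weight one. -/
def IsThinOutsideKer (f : K →ₗ[F] K) : Prop :=
  ∀ x y : K, f x ≠ 0 → x * f y = y * f x → ∃ s : F, y = s • x

lemma graph_inf_span_inl (f : K →ₗ[F] K) {x : K} (hx : x ≠ 0) :
    f.graph ⊓ (Submodule.span K {(x, (0 : K))}).restrictScalars F =
      f.ker.map (LinearMap.inl F K K) := by
  ext ⟨y, z⟩
  constructor
  · rintro ⟨hyz, hspan⟩
    obtain ⟨k, hk⟩ := Submodule.mem_span_singleton.1 hspan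
    obtain rfl : 0 = z := by simpa using congrArg Prod.snd hk
    exact ⟨y, ((LinearMap.mem_graph_iff f _).1 hyz).symm, rfl⟩
  · rintro ⟨y, hy, hyz⟩
    obtain ⟨rfl, rfl⟩ := Prod.mk.inj hyz
    exact ⟨(LinearMap.mem_graph_iff f _).2 (LinearMap.mem_ker.1 hy).symm,
      Submodule.mem_span_singleton.2 ⟨y / x, by simp [hx]⟩⟩

lemma IsThinOutsideKer.graph_inf_span (hf : IsThinOutsideKer f) {x : K} (hfx : f x ≠ 0) :
    f.graph ⊓ (Submodule.span K {(x, f x)}).restrictScalars F = Submodule.span F {(x, f x)} := by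
  refine le_antisymm ?_ ?_
  · rintro ⟨y, z⟩ ⟨hy, hyz⟩
    obtain rfl : z = f y := (LinearMap.mem_graph_iff f _).1 hy
    obtain ⟨k, hk⟩ := Submodule.mem_span_singleton.1 hyz
    obtain ⟨hkx : k * x = y, hkf : k * f x = f y⟩ := Prod.mk.inj hk
    obtain ⟨s, rfl⟩ := hf x y hfx (by linear_combination f x * hkx - x * hkf)
    exact Submodule.mem_span_singleton.2 ⟨s, by simp⟩
  · rw [Submodule.span_singleton_le_iff_mem]
    exact ⟨(LinearMap.mem_graph_iff f _).2 rfl, Submodule.mem_span_singleton_self _⟩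

lemma IsThinOutsideKer.isClubPolynomial (hf : IsThinOutsideKer f) (hker : f.ker ≠ ⊥) :
    IsClubPolynomial (finrank F f.ker) f := by
  obtain ⟨x₀, (hfx₀ : f x₀ = 0), hx₀⟩ := Submodule.exists_mem_ne_zero_of_ne_bot hker
  have hne : (x₀, (0 : K)) ≠ 0 := fun h => hx₀ (congrArg Prod.fst h)
  refine ⟨Projectivization.mk K (x₀, 0) hne,
    ⟨_, hne, (LinearMap.mem_graph_iff f _).2 hfx₀.symm, rfl⟩, ?_, ?_⟩
  · rw [setWeight, Projectivization.submodule_mk, graph_inf_span_inl f hx₀]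
    exact (Submodule.equivMapOfInjective _ LinearMap.inl_injective _).finrank_eq.symm
  · rintro _ ⟨⟨x, y⟩, hxy, hmem, rfl⟩ hQ
    obtain rfl : y = f x := (LinearMap.mem_graph_iff f _).1 hmem
    have hfx : f x ≠ 0 := fun h => hQ <| by
      rw [Projectivization.mk_eq_mk_iff']
      exact ⟨x / x₀, by simp [hx₀, h]⟩
    rw [setWeight, Projectivization.submodule_mk, hf.graph_inf_span hfx,
      finrank_span_singleton hxy]

lemma IsThinOutsideKer.sub_mul_ne (hf : IsThinOutsideKer f) (hb : LinearIndependent F ![1, b])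
    {x₁ x₂ s s' : K} (hx₁ : f x₁ = 1) (hx₂ : f x₂ = b) (hs : f s = 0) (hs' : f s' = 0) :
    x₂ - b * x₁ ≠ s + b * s' := by
  intro hss
  have e1 : f (x₁ + s') = 1 := by rw [map_add, hx₁, hs', add_zero]
  have e2 : f (x₂ - s) = b := by rw [map_sub, hx₂, hs, sub_zero]
  obtain ⟨k, hk⟩ := hf (x₁ + s') (x₂ - s) (by rw [e1]; exact one_ne_zero) (by
    rw [e1, e2]
    linear_combination -hss)
  refine notMem_range_of_linearIndependent hb ⟨k, ?_⟩
  rw [← e2, hk, map_smul, e1, Algebra.algebraMap_eq_smul_one]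

lemma disjoint_span_mul_pow {S : Submodule F⟮b⟯ K} {c : K} (hc : c ∉ S) (m : ℕ) :
    Disjoint (S.restrictScalars F)
      (Submodule.span F ((fun i : ℕ => c * b ^ i) '' Set.Iio m)) := by
  have hle : Submodule.span F ((fun i : ℕ => c * b ^ i) '' Set.Iio m) ≤
      ((LinearMap.toSpanSingleton F⟮b⟯ K c).restrictScalars F).range := by
    rw [Submodule.span_le]
    rintro _ ⟨i, -, rfl⟩
    exact ⟨AdjoinSimple.gen F b ^ i, by simp [Algebra.smul_def, mul_comm]⟩
  rw [Submodule.disjoint_def]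
  intro x hxS hxT
  obtain ⟨y, rfl⟩ := hle hxT
  by_contra hne
  have hy : y ≠ 0 := by
    rintro rfl
    exact hne (map_zero _)
  refine hc ?_
  have := S.smul_mem y⁻¹ hxS
  simpa [smul_smul, hy] using this

variable [FiniteDimensional F K]

lemma exists_trace_pow_mul_eq_zero (b : K) {m : ℕ} (hm : m < finrank F K) :
    ∃ l : K, l ≠ 0 ∧ ∀ i < m, Algebra.trace F K (b ^ i * l) = 0 := by
  let h : K →ₗ[F] (Fin m → F) :=
    LinearMap.pi fun i => Algebra.trace F K ∘ₗ LinearMap.mulLeft F (b ^ (i : ℕ))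
  have hker : h.ker ≠ ⊥ := LinearMap.ker_ne_bot_of_finrank_lt (by rwa [finrank_fin_fun])
  obtain ⟨l, hl, hl0⟩ := Submodule.exists_mem_ne_zero_of_ne_bot hker
  exact ⟨l, hl0, fun i hi => congrFun (LinearMap.mem_ker.1 hl) ⟨i, hi⟩⟩

lemma finrank_span_mul_pow {c : K} (hc : c ≠ 0) {m : ℕ} (hm : m ≤ finrank F F⟮b⟯) :
    finrank F (Submodule.span F ((fun i : ℕ => c * b ^ i) '' Set.Iio m)) = m := by
  have hli : LinearIndependent F (fun i : Fin m => c * b ^ (i : ℕ)) := by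
    rw [adjoin.finrank (Algebra.IsIntegral.isIntegral b)] at hm
    exact ((linearIndependent_pow b).comp _ (Fin.castLE_injective hm)).map'
      (LinearMap.mulLeft F c) (LinearMap.ker_eq_bot.2 (mul_right_injective₀ hc))
  have hrange : (fun i : ℕ => c * b ^ i) '' Set.Iio m =
      Set.range (fun i : Fin m => c * b ^ (i : ℕ)) := by
    rw [← Fin.range_val, ← Set.range_comp]
    rfl
  rw [hrange, finrank_span_eq_card hli, Fintype.card_fin]

lemma finrank_sup_span_mul_pow {S : Submodule F⟮b⟯ K} {c : K} (hc : c ∉ S) {m : ℕ}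
    (hm : m ≤ finrank F F⟮b⟯) :
    finrank F ↥(S.restrictScalars F ⊔
      Submodule.span F ((fun i : ℕ => c * b ^ i) '' Set.Iio m)) =
      finrank F F⟮b⟯ * finrank F⟮b⟯ S + m := by
  have hc0 : c ≠ 0 := by
    rintro rfl
    exact hc (zero_mem _)
  have hsup := Submodule.finrank_sup_add_finrank_inf_eq (S.restrictScalars F)
    (Submodule.span F ((fun i : ℕ => c * b ^ i) '' Set.Iio m))
  rw [disjoint_iff.1 (disjoint_span_mul_pow hc m), finrank_bot, add_zero,
    finrank_span_mul_pow hc0 hm] at hsup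
  rw [hsup, finrank_mul_finrank F F⟮b⟯ S]
  rfl

/-- The `F(b)`-subspace is the kernel of `x ↦ Tr_{K/F(b)} (θ x)`, and this map sends `c` to an
element of `F(b)` orthogonal to `1, b, …, b ^ (t - 2)`, where `t = [F(b) : F]`. -/
lemma exists_eq_sup_span_mul_pow [Algebra.IsSeparable F K] {θ : K} (hθ : θ ≠ 0)
    (hb : 2 ≤ finrank F F⟮b⟯) {S₀ : Submodule F K} (hS₀ : finrank F S₀ + 2 = finrank F K)
    (hmem : ∀ x, x ∈ S₀ ↔
      Algebra.trace F K (θ * x) = 0 ∧ Algebra.trace F K (θ * b * x) = 0) :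
    ∃ (c : K) (S : Submodule F⟮b⟯ K), c ≠ 0 ∧
      finrank F F⟮b⟯ * (finrank F⟮b⟯ S + 1) = finrank F K ∧
      Disjoint (S.restrictScalars F)
        (Submodule.span F ((fun i : ℕ => c * b ^ i) '' Set.Iio (finrank F F⟮b⟯ - 2))) ∧
      S₀ = S.restrictScalars F ⊔
        Submodule.span F ((fun i : ℕ => c * b ^ i) '' Set.Iio (finrank F F⟮b⟯ - 2)) := by
  have : Algebra.IsSeparable F⟮b⟯ K := Algebra.isSeparable_tower_top_of_isSeparable F F⟮b⟯ K
  let g : K →ₗ[F⟮b⟯] F⟮b⟯ := Algebra.trace F⟮b⟯ K ∘ₗ LinearMap.mulLeft F⟮b⟯ θ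
  have hg_pow (i : ℕ) (x : K) : g (b ^ i * x) = AdjoinSimple.gen F b ^ i * g x := by
    rw [← smul_eq_mul (AdjoinSimple.gen F b ^ i), ← map_smul, Algebra.smul_def, map_pow,
      AdjoinSimple.algebraMap_gen]
  have hmem' (x : K) : x ∈ S₀ ↔ Algebra.trace F F⟮b⟯ (g x) = 0 ∧
      Algebra.trace F F⟮b⟯ (AdjoinSimple.gen F b * g x) = 0 := by
    rw [hmem, ← pow_one (AdjoinSimple.gen F b), ← hg_pow, pow_one, mul_assoc θ]
    exact and_congr (by rw [← Algebra.trace_trace (S := F⟮b⟯)]; rfl)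
      (by rw [← Algebra.trace_trace (S := F⟮b⟯)]; rfl)
  have hsurj : Function.Surjective g :=
    (Algebra.trace_surjective F⟮b⟯ K).comp (mul_left_surjective₀ hθ)
  have hdim : finrank F F⟮b⟯ * (finrank F⟮b⟯ g.ker + 1) = finrank F K := by
    rw [← finrank_mul_finrank F F⟮b⟯ K, ← g.finrank_range_add_finrank_ker,
      LinearMap.range_eq_top.2 hsurj, finrank_top, finrank_self, add_comm 1]
  obtain ⟨l, hl0, hl⟩ := exists_trace_pow_mul_eq_zero (AdjoinSimple.gen F b)
    (show finrank F F⟮b⟯ - 1 < finrank F F⟮b⟯ by omega)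
  obtain ⟨c, hc⟩ := hsurj l
  have hcker : c ∉ g.ker := fun h => hl0 (hc.symm.trans h)
  refine ⟨c, g.ker, (ne_of_mem_of_not_mem (zero_mem _) hcker).symm, hdim,
    disjoint_span_mul_pow hcker _,
    (Submodule.eq_of_le_of_finrank_eq (sup_le (fun x hx => ?_) ?_) ?_).symm⟩
  · rw [hmem', LinearMap.mem_ker.1 hx, mul_zero, map_zero]
    exact ⟨rfl, rfl⟩
  · rw [Submodule.span_le]
    rintro _ ⟨i, hi, rfl⟩
    rw [Set.mem_Iio] at hi
    change c * b ^ i ∈ S₀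
    rw [hmem', mul_comm c, hg_pow, hc, ← mul_assoc, ← pow_succ']
    exact ⟨hl i (by omega), hl (i + 1) (by omega)⟩
  · rw [finrank_sup_span_mul_pow hcker (Nat.sub_le _ _)]
    rw [mul_add] at hdim
    omega

lemma two_le_finrank_adjoin (hb : b ∉ Set.range (algebraMap F K)) : 2 ≤ finrank F F⟮b⟯ := by
  have hpos : 0 < finrank F F⟮b⟯ := finrank_pos
  have hne : finrank F F⟮b⟯ ≠ 1 := by
    rwa [Ne, finrank_adjoin_simple_eq_one_iff, mem_bot]
  omega

lemma finrank_ker_add_two (hb : LinearIndependent F ![1, b])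
    (hf : f.range = Submodule.span F {1, b}) : finrank F f.ker + 2 = finrank F K := by
  rw [← f.finrank_range_add_finrank_ker, hf, linearIndependent_pair_iff_finrank_span.1 hb, add_comm]

lemma exists_smul_of_finrank_ker_le_one (hf : finrank F f.ker ≤ 1) {x y : K} (hx0 : x ≠ 0)
    (hx : f x = 0) (hy : f y = 0) : ∃ s : F, y = s • x := by
  have hle : Submodule.span F {x} ≤ f.ker := by
    rwa [Submodule.span_singleton_le_iff_mem]
  have heq := Submodule.eq_of_le_of_finrank_le hle (by rwa [finrank_span_singleton hx0])
  obtain ⟨s, hs⟩ := Submodule.mem_span_singleton.1 (heq.ge hy)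
  exact ⟨s, hs.symm⟩

lemma isThinOutsideKer_of_le_finrank_range {D : Submodule K (K →ₗ[F] K)}
    (hid : LinearMap.id ∈ D) (hf : f ∈ D) (hli : LinearIndependent K ![LinearMap.id, f])
    (h : ∀ g ∈ D, g ∉ Submodule.span K {f} → finrank F K - 1 ≤ finrank F g.range) :
    IsThinOutsideKer f := by
  intro x y hfx hxy
  have hx0 : x ≠ 0 := by
    rintro rfl
    exact hfx (map_zero f)
  have hnot : f x • LinearMap.id - x • f ∉ Submodule.span K {f} := by
    intro hmem
    obtain ⟨k, hk⟩ := Submodule.mem_span_singleton.1 hmem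
    refine hfx (LinearIndependent.pair_iff.1 hli (f x) (-(x + k)) ?_).1
    rw [neg_smul, add_smul, hk]
    abel
  have hrange := h _ (D.sub_mem (D.smul_mem _ hid) (D.smul_mem _ hf)) hnot
  have hker := (f x • LinearMap.id - x • f).finrank_range_add_finrank_ker
  have hpos : 0 < finrank F K := finrank_pos
  refine exists_smul_of_finrank_ker_le_one (f := f x • LinearMap.id - x • f) (by omega) hx0 ?_ ?_
  · simp [mul_comm]
  · simp [hxy, mul_comm]

section Separable

variable [Algebra.IsSeparable F K]

lemma exists_forall_trace_mul_eq_zero {S : Submodule F K} (hS : S ≠ ⊤) :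
    ∃ θ : K, θ ≠ 0 ∧ ∀ x ∈ S, Algebra.trace F K (θ * x) = 0 := by
  obtain ⟨φ, hφ0, hφ⟩ := Submodule.exists_le_ker_of_lt_top _ (lt_top_iff_ne_top.2 hS)
  obtain ⟨θ, hθ⟩ := exists_eq_trace_mul φ
  refine ⟨θ, ?_, fun x hx => (hθ x).symm.trans (hφ hx)⟩
  rintro rfl
  exact hφ0 (LinearMap.ext fun x => by simp [hθ])

lemma mem_iff_trace_mul_eq_zero {S : Submodule F K} (hS : finrank F S + 2 = finrank F K) {u v : K}
    (huv : LinearIndependent F ![u, v])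
    (hle : ∀ x ∈ S, Algebra.trace F K (u * x) = 0 ∧ Algebra.trace F K (v * x) = 0) {x : K} :
    x ∈ S ↔ Algebra.trace F K (u * x) = 0 ∧ Algebra.trace F K (v * x) = 0 := by
  let S' := (Algebra.traceForm F K).orthogonal (Submodule.span F {u, v})
  have hS' (x : K) : x ∈ S' ↔ Algebra.trace F K (u * x) = 0 ∧ Algebra.trace F K (v * x) = 0 :=
    forall_mem_span_pair_trace_mul
  have heq : S = S' := by
    refine Submodule.eq_of_le_of_finrank_eq (fun x hx => (hS' x).2 (hle x hx)) ?_
    rw [LinearMap.BilinForm.finrank_orthogonal (traceForm_nondegenerate F K),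
      linearIndependent_pair_iff_finrank_span.1 huv]
    omega
  rw [heq, hS']

/-- The kernel and its multiple by `b` do not span `K`, and any `θ` orthogonal to both will do. -/
lemma IsThinOutsideKer.exists_mem_ker_iff_trace (hf : IsThinOutsideKer f)
    (hb : LinearIndependent F ![1, b]) (hr : f.range = Submodule.span F {1, b}) :
    ∃ θ : K, θ ≠ 0 ∧ ∀ x, x ∈ f.ker ↔
      Algebra.trace F K (θ * x) = 0 ∧ Algebra.trace F K (θ * b * x) = 0 := by
  obtain ⟨x₁, hx₁⟩ : (1 : K) ∈ f.range := hr ▸ Submodule.mem_span_pair.2 ⟨1, 0, by simp⟩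
  obtain ⟨x₂, hx₂⟩ : b ∈ f.range := hr ▸ Submodule.mem_span_pair.2 ⟨0, 1, by simp⟩
  have hne : f.ker ⊔ f.ker.map (LinearMap.mulLeft F b) ≠ ⊤ := by
    intro htop
    have hmem : x₂ - b * x₁ ∈ f.ker ⊔ f.ker.map (LinearMap.mulLeft F b) :=
      htop ▸ Submodule.mem_top
    obtain ⟨s, hs, _, ⟨s', hs', rfl⟩, hss⟩ := Submodule.mem_sup.1 hmem
    exact hf.sub_mul_ne hb hx₁ hx₂ hs hs' hss.symm
  obtain ⟨θ, hθ0, hθ⟩ := exists_forall_trace_mul_eq_zero hne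
  have hθb : LinearIndependent F ![θ, θ * b] := by
    rw [linearIndependent_pair_iff_finrank_span] at hb ⊢
    rw [← hb, ← finrank_map_mulLeft hθ0 (Submodule.span F {1, b}), map_mulLeft_span_pair, mul_one]
  refine ⟨θ, hθ0, fun x => mem_iff_trace_mul_eq_zero (finrank_ker_add_two hb hr) hθb fun x hx =>
    ⟨hθ x (Submodule.mem_sup_left hx), ?_⟩⟩
  rw [mul_assoc]
  exact hθ _ (Submodule.mem_sup_right ⟨x, hx, rfl⟩)

lemma IsThinOutsideKer.isTraceClubForm (hf : IsThinOutsideKer f)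
    (hb : LinearIndependent F ![1, b]) (hr : f.range = Submodule.span F {1, b}) :
    IsTraceClubForm f := by
  have hbF := notMem_range_of_linearIndependent hb
  obtain ⟨θ, hθ0, hθ⟩ := hf.exists_mem_ker_iff_trace hb hr
  obtain ⟨c, S, hc0, hdim, hdis, hS⟩ := exists_eq_sup_span_mul_pow hθ0
    (two_le_finrank_adjoin hbF) (finrank_ker_add_two hb hr) hθ
  obtain ⟨ξ, η, hξη⟩ := exists_eq_Tr_add_mul_Tr hb hr
  refine ⟨b, ξ, η, c, hbF, ?_, ?_, hc0, hξη, S, hdim, hdis, fun x => ?_⟩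
  · rintro rfl
    obtain ⟨x, hx⟩ : (1 : K) ∈ f.range := hr ▸ Submodule.mem_span_pair.2 ⟨1, 0, by simp⟩
    rw [hξη, zero_mul, mul_comm b, Tr_mul, Tr, map_zero, map_zero, zero_add] at hx
    have := LinearIndependent.pair_iff.1 hb (-1) (Algebra.trace F K (η * x)) (by
      rw [hx]
      simp)
    simp at this
  · rintro rfl
    obtain ⟨x, hx⟩ : b ∈ f.range := hr ▸ Submodule.mem_span_pair.2 ⟨0, 1, by simp⟩
    rw [hξη, zero_mul, Tr, Tr, map_zero, map_zero, mul_zero, add_zero] at hx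
    exact hbF ⟨_, hx⟩
  · rw [← hS, forall_mem_span_pair_trace_mul, LinearMap.mem_ker, hξη,
      Tr_add_mul_Tr_eq_zero_iff hb]

end Separable

end Clubs

section Frobenius

variable (F : Type*) {K : Type*} [Field F] [Field K] [Algebra F K] [Finite F]

/-- The Frobenius endomorphism `x ↦ x ^ q` over the field `F` of order `q`. -/
noncomputable def frob : K →ₐ[F] K :=
  letI := Fintype.ofFinite F
  FiniteField.frobeniusAlgHom F K

lemma frob_apply (x : K) : frob F x = x ^ Nat.card F := by
  let := Fintype.ofFinite F
  rw [← Fintype.card_eq_nat_card]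
  rfl

lemma frob_injective : Function.Injective (frob F : K →ₐ[F] K) :=
  (frob F : K →ₐ[F] K).toRingHom.injective

lemma frob_pow_apply (k : ℕ) (x : K) : (frob F ^ k) x = x ^ (Nat.card F ^ k) := by
  induction k with
  | zero => simp
  | succ k ih => rw [pow_succ', AlgHom.mul_apply, ih, frob_apply, ← pow_mul, pow_succ]

lemma pow_card_pow_finrank [FiniteDimensional F K] (x : K) :
    x ^ (Nat.card F ^ finrank F K) = x := by
  have : Finite K := Module.finite_of_finite F
  have := Fintype.ofFinite K
  rw [← Module.natCard_eq_pow_finrank, ← Fintype.card_eq_nat_card, FiniteField.pow_card]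

variable {F}

lemma finrank_le_of_eval_eq_zero [FiniteDimensional F K] {M : Submodule F K} {P : Polynomial K}
    {k : ℕ} (hP : P ≠ 0) (hdeg : P.natDegree ≤ Nat.card F ^ k) (hM : ∀ x ∈ M, P.eval x = 0) :
    finrank F M ≤ k := by
  classical
  have hsub : (M : Set K) ⊆ P.roots.toFinset := fun x hx => by simpa [hP] using hM x hx
  have hle := Set.ncard_le_ncard hsub (Finset.finite_toSet _)
  rw [Set.ncard_coe_finset] at hle
  have hcard : Nat.card M = Nat.card F ^ finrank F M := Module.natCard_eq_pow_finrank
  refine (Nat.pow_le_pow_iff_right Finite.one_lt_card).1 (hcard.symm.le.trans (hle.trans ?_))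
  exact (Multiset.toFinset_card_le _).trans ((Polynomial.card_roots' P).trans hdeg)

lemma mem_eqLocus_frob_pow {k : ℕ} {x : K} :
    x ∈ LinearMap.eqLocus (frob F ^ k : K →ₐ[F] K).toLinearMap LinearMap.id ↔
      x ^ (Nat.card F ^ k) = x := by
  rw [← frob_pow_apply]
  rfl

lemma finrank_eqLocus_frob_pow_le [FiniteDimensional F K] {k : ℕ} (hk : k ≠ 0) :
    finrank F (LinearMap.eqLocus (frob F ^ k : K →ₐ[F] K).toLinearMap LinearMap.id) ≤ k := by
  have hq : 1 < Nat.card F ^ k := Nat.one_lt_pow hk Finite.one_lt_card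
  refine finrank_le_of_eval_eq_zero (FiniteField.X_pow_card_sub_X_ne_zero K hq)
    (FiniteField.X_pow_card_sub_X_natDegree_eq K hq).le fun x hx => ?_
  rw [Polynomial.eval_sub, Polynomial.eval_pow, Polynomial.eval_X, mem_eqLocus_frob_pow.1 hx,
    sub_self]

lemma mem_range_algebraMap_of_pow_card_eq [FiniteDimensional F K] {x : K}
    (hx : x ^ Nat.card F = x) : x ∈ Set.range (algebraMap F K) := by
  have hfix {y : K} := mem_eqLocus_frob_pow (F := F) (k := 1) (x := y)
  rw [pow_one (Nat.card F)] at hfix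
  have heq := Submodule.eq_of_le_of_finrank_le
    ((Submodule.span_singleton_le_iff_mem 1 _).2 (hfix.2 (one_pow _)))
    ((finrank_eqLocus_frob_pow_le one_ne_zero).trans (finrank_span_singleton one_ne_zero).ge)
  obtain ⟨s, hs⟩ := Submodule.mem_span_singleton.1 (heq.ge (hfix.2 hx))
  exact ⟨s, by rw [← hs, Algebra.algebraMap_eq_smul_one]⟩

lemma mem_span_pair_iff_pow_eq [FiniteDimensional F K] {a : K} (ha : LinearIndependent F ![1, a])
    (haq : a ^ (Nat.card F ^ 2) = a) (x : K) :
    x ∈ Submodule.span F {1, a} ↔ x ^ (Nat.card F ^ 2) = x := by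
  rw [← mem_eqLocus_frob_pow (k := 2)]
  refine iff_of_eq congr(x ∈ $(Submodule.eq_of_le_of_finrank_le ?_ ?_))
  · rw [Submodule.span_le, Set.pair_subset_iff]
    exact ⟨mem_eqLocus_frob_pow.2 (one_pow _), mem_eqLocus_frob_pow.2 haq⟩
  · rw [linearIndependent_pair_iff_finrank_span.1 ha]
    exact finrank_eqLocus_frob_pow_le two_ne_zero

end Frobenius

section RankFour

variable {F K : Type*} [Field F] [Field K] [Algebra F K] [FiniteDimensional F K]

lemma isDualBasisForm_of_apply [Algebra.IsSeparable F K] (h4 : finrank F K = 4) {e : Fin 4 → K}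
    (he : LinearIndependent F e) {b : K} {f : K →ₗ[F] K} (h0 : f (e 0) = 0) (h1 : f (e 1) = 0)
    (h2 : f (e 2) = 1) (h3 : f (e 3) = b) : IsDualBasisForm e b f := by
  have hspan : Submodule.span F (Set.range e) = ⊤ :=
    he.span_eq_top_of_card_eq_finrank (by rw [h4, Fintype.card_fin])
  obtain ⟨ξ, hξ⟩ := exists_eq_sum_Tr_mul he (g := LinearMap.id) (hspan ▸ le_top)
  simp only [LinearMap.id_apply, Tr_mul] at hξ
  refine ⟨he, ξ, fun i j => ?_, fun x => ?_⟩
  · have h := Fintype.linearIndependent_iff.1 he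
      (fun k => Algebra.trace F K (ξ k * e i) - if i = k then 1 else 0)
      (by simp [sub_smul, ← hξ]) j
    rw [mul_comm]
    exact sub_eq_zero.1 h
  · have h : f x = ∑ i, Algebra.trace F K (ξ i * x) • f (e i) := by
      simp_rw [← map_smul, ← map_sum]
      rw [← hξ x]
    rw [h, Fin.sum_univ_four, h0, h1, h2, h3, smul_zero, smul_zero, zero_add, zero_add, mul_comm b,
      Tr_mul, ← Algebra.algebraMap_eq_smul_one]
    rfl

lemma sub_one_mul_sub_one_lt {a b c : ℕ} (ha : 1 ≤ a) (hb : 1 ≤ b) (hc : 2 ≤ c)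
    (habc : a * b ≤ c) : (a - 1) * (b - 1) < c - 1 := by
  obtain ⟨a, rfl⟩ := Nat.exists_eq_add_of_le' ha
  obtain ⟨b, rfl⟩ := Nat.exists_eq_add_of_le' hb
  rw [Nat.add_sub_cancel, Nat.add_sub_cancel]
  have hab : a = 0 ∨ 1 ≤ a := by omega
  rcases hab with rfl | ha
  · omega
  · have : (a + 1) * (b + 1) = a * b + a + b + 1 := by ring
    rcases Nat.eq_zero_or_pos b with rfl | hb <;> omega

lemma exists_ne_zero_disjoint_map_mulLeft [Finite F] {S T : Submodule F K}
    (hST : finrank F S + finrank F T ≤ finrank F K) :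
    ∃ ω : K, ω ≠ 0 ∧ Disjoint S (T.map (LinearMap.mulLeft F ω)) := by
  have : Finite K := Module.finite_of_finite F
  by_contra! hcon
  have hsub : ({0}ᶜ : Set K) ⊆
      (fun p : K × K => p.1 / p.2) '' (((S : Set K) \ {0}) ×ˢ ((T : Set K) \ {0})) := by
    intro ω hω
    obtain ⟨s, ⟨hs, t, ht, rfl⟩, hst⟩ :=
      Submodule.exists_mem_ne_zero_of_ne_bot (disjoint_iff.not.1 (hcon ω hω))
    have ht0 : t ≠ 0 := right_ne_zero_of_mul hst
    exact ⟨(ω * t, t), ⟨⟨hs, hst⟩, ht, ht0⟩, mul_div_cancel_right₀ _ ht0⟩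
  have hle := (Set.ncard_le_ncard hsub (Set.toFinite _)).trans Set.ncard_image_le
  rw [Set.ncard_compl, Set.ncard_singleton, Set.ncard_prod,
    Set.ncard_sdiff_singleton_of_mem S.zero_mem, Set.ncard_sdiff_singleton_of_mem T.zero_mem] at hle
  refine hle.not_gt (sub_one_mul_sub_one_lt Nat.card_pos Nat.card_pos Finite.one_lt_card ?_)
  change Nat.card S * Nat.card T ≤ Nat.card K
  rw [Module.natCard_eq_pow_finrank (K := F) (V := S),
    Module.natCard_eq_pow_finrank (K := F) (V := T),
    Module.natCard_eq_pow_finrank (K := F) (V := K), ← pow_add]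
  exact Nat.pow_le_pow_right Nat.card_pos hST

omit [FiniteDimensional F K] in
lemma linearIndependent_of_disjoint {a b c d : K} (hab : LinearIndependent F ![a, b])
    (hcd : LinearIndependent F ![c, d])
    (hdisj : Disjoint (Submodule.span F {a, b}) (Submodule.span F {c, d})) :
    LinearIndependent F ![a, b, c, d] := by
  have h := hab.sum_type hcd (by simpa only [Matrix.range_cons_cons_empty] using hdisj)
  rw [← linearIndependent_equiv (finSumFinEquiv (m := 2) (n := 2)).symm] at h
  have heq :
      Sum.elim ![a, b] ![c, d] ∘ (finSumFinEquiv (m := 2) (n := 2)).symm = ![a, b, c, d] := by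
    ext i
    fin_cases i <;> rfl
  rwa [heq] at h

end RankFour

section TwoPoints

variable {F K : Type*} [Field F] [Field K] [Algebra F K] {n : ℕ}
  {C : Submodule K (Fin (n + 1) → K)} {D : Submodule K (K →ₗ[F] K)} {k₁ k₂ : K →ₗ[F] K}

lemma IsPencilOf.span_pair_eq (hD : IsPencilOf D C) (hk₁ : k₁ ∈ D) (hk₂ : k₂ ∈ D)
    (hk : LinearIndependent K ![k₁, k₂]) : Submodule.span K {k₁, k₂} = D :=
  span_pair_eq_of_finrank_eq_two hD.finrank_eq hk₁ hk₂ hk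

lemma IsPencilOf.disjoint_ker (hD : IsPencilOf D C) (hk₁ : k₁ ∈ D) (hk₂ : k₂ ∈ D)
    (hk : LinearIndependent K ![k₁, k₂]) : Disjoint k₁.ker k₂.ker := by
  rw [Submodule.disjoint_def]
  intro x hx₁ hx₂
  obtain ⟨α, β, hid⟩ := Submodule.mem_span_pair.1 ((hD.span_pair_eq hk₁ hk₂ hk).ge hD.id_mem)
  have h := LinearMap.congr_fun hid x
  rw [LinearMap.add_apply, LinearMap.smul_apply, LinearMap.smul_apply, LinearMap.mem_ker.1 hx₁,
    LinearMap.mem_ker.1 hx₂, smul_zero, smul_zero, add_zero] at h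
  exact h.symm

lemma exists_apply_eq_and_apply_eq [FiniteDimensional F K] (hdisj : Disjoint k₁.ker k₂.ker)
    (hdim : finrank F k₁.range + finrank F k₂.range = finrank F K) {s t : K} (hs : s ∈ k₁.range)
    (ht : t ∈ k₂.range) : ∃ x, k₁ x = s ∧ k₂ x = t := by
  let p : K →ₗ[F] k₁.range × k₂.range := k₁.rangeRestrict.prod k₂.rangeRestrict
  have hinj : Function.Injective p := by
    rw [← LinearMap.ker_eq_bot, LinearMap.ker_prod, LinearMap.ker_rangeRestrict,
      LinearMap.ker_rangeRestrict]
    exact hdisj.eq_bot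
  obtain ⟨x, hx⟩ := (LinearMap.injective_iff_surjective_of_finrank_eq_finrank
    (by rw [Module.finrank_prod, hdim])).1 hinj (⟨s, hs⟩, ⟨t, ht⟩)
  exact ⟨x, congr($hx.1.1), congr($hx.2.1)⟩

lemma injective_add_smul (hker : Disjoint k₁.ker k₂.ker) {ω : K} (hω : ω ≠ 0)
    (hrange : Disjoint k₁.range (k₂.range.map (LinearMap.mulLeft F ω))) :
    Function.Injective (k₁ + ω • k₂) := by
  rw [← LinearMap.ker_eq_bot, LinearMap.ker_eq_bot']
  intro x hx
  have hx₁ : k₁ x = -(ω * k₂ x) := eq_neg_of_add_eq_zero_left hx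
  have h0 : k₁ x = 0 := Submodule.disjoint_def.1 hrange _ ⟨x, rfl⟩
    (hx₁ ▸ Submodule.neg_mem _ ⟨k₂ x, ⟨x, rfl⟩, rfl⟩)
  rw [h0, zero_eq_neg] at hx₁
  exact Submodule.disjoint_def.1 hker x h0 ((mul_eq_zero.1 hx₁).resolve_left hω)

lemma IsPencilOf.exists_isDualBasisForm [Finite F] [FiniteDimensional F K]
    [Algebra.IsSeparable F K] (hD : IsPencilOf D C) (h4 : finrank F K = 4) (hk₁ : k₁ ∈ D)
    (hk₂ : k₂ ∈ D) (hk : LinearIndependent K ![k₁, k₂]) {a b : K}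
    (ha : LinearIndependent F ![1, a]) (hb : LinearIndependent F ![1, b])
    (hr₁ : k₁.range = Submodule.span F {1, a}) (hr₂ : k₂.range = Submodule.span F {1, b}) :
    ∃ (ω : K) (f : K →ₗ[F] K), IsDualBasisForm ![1, a, ω, ω * b] b f ∧
      IsRepresentedBy F C f := by
  have hdim₁ := linearIndependent_pair_iff_finrank_span.1 ha
  have hdim₂ := linearIndependent_pair_iff_finrank_span.1 hb
  have hdisj := hD.disjoint_ker hk₁ hk₂ hk
  obtain ⟨ω, hω, hST⟩ := exists_ne_zero_disjoint_map_mulLeft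
    (S := Submodule.span F {1, a}) (T := Submodule.span F {1, b}) (by omega)
  have hinj := injective_add_smul hdisj hω (by rwa [hr₁, hr₂])
  rw [map_mulLeft_span_pair, mul_one] at hST
  have hωb : LinearIndependent F ![ω, ω * b] := by
    rw [linearIndependent_pair_iff_finrank_span, ← mul_one ω, mul_assoc, one_mul,
      ← map_mulLeft_span_pair, finrank_map_mulLeft hω, hdim₂]
  let f : K →ₗ[F] K := k₂ ∘ₗ (LinearEquiv.ofInjectiveEndo _ hinj).symm.toLinearMap
  have hf (x : K) : f (k₁ x + ω * k₂ x) = k₂ x :=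
    congrArg k₂ ((LinearEquiv.ofInjectiveEndo _ hinj).symm_apply_apply x)
  have hval {s t : K} (hs : s ∈ Submodule.span F {1, a}) (ht : t ∈ Submodule.span F {1, b}) :
      f (s + ω * t) = t := by
    obtain ⟨x, rfl, rfl⟩ := exists_apply_eq_and_apply_eq hdisj (by rw [hr₁, hr₂]; omega)
      (hr₁.ge hs) (hr₂.ge ht)
    exact hf x
  have hmem (c : K) : 1 ∈ Submodule.span F {1, c} ∧ c ∈ Submodule.span F {1, c} :=
    ⟨Submodule.subset_span (.inl rfl), Submodule.subset_span (.inr rfl)⟩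
  refine ⟨ω, f, isDualBasisForm_of_apply h4 (linearIndependent_of_disjoint ha hωb hST) ?_ ?_ ?_ ?_,
    hD.isRepresentedBy (D.add_mem hk₁ (D.smul_mem ω hk₂)) hk₂
      ((LinearIndependent.pair_add_smul_left_iff ω).2 hk) hinj hf⟩
  · simpa using hval (hmem a).1 (Submodule.zero_mem _)
  · simpa using hval (hmem a).2 (Submodule.zero_mem _)
  · simpa using hval (Submodule.zero_mem _) (hmem b).1
  · simpa using hval (Submodule.zero_mem _) (hmem b).2

lemma range_smul_eq_map_mulLeft (α : K) (f : K →ₗ[F] K) :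
    (α • f).range = f.range.map (LinearMap.mulLeft F α) := by
  rw [← LinearMap.range_comp]
  rfl

lemma IsPencilOf.not_pow_eq_and_pow_eq [Finite F] [FiniteDimensional F K] (hD : IsPencilOf D C)
    (h4 : finrank F K = 4) (hker : ∃ h ∈ D, finrank F h.ker = 1) (hk₁ : k₁ ∈ D)
    (hk₂ : k₂ ∈ D) (hk : LinearIndependent K ![k₁, k₂]) {a b : K}
    (ha : LinearIndependent F ![1, a]) (hb : LinearIndependent F ![1, b])
    (hr₁ : k₁.range = Submodule.span F {1, a}) (hr₂ : k₂.range = Submodule.span F {1, b}) :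
    ¬(a ^ (Nat.card F ^ 2) = a ∧ b ^ (Nat.card F ^ 2) = b) := by
  rintro ⟨haq, hbq⟩
  have hdim₁ := linearIndependent_pair_iff_finrank_span.1 ha
  have hdim₂ := linearIndependent_pair_iff_finrank_span.1 hb
  have hdisj := hD.disjoint_ker hk₁ hk₂ hk
  obtain ⟨h, hhD, hh⟩ := hker
  obtain ⟨x, hx, hx0⟩ := Submodule.exists_mem_ne_zero_of_ne_bot
    (Submodule.one_le_finrank_iff.1 hh.ge)
  obtain ⟨α, β, rfl⟩ := Submodule.mem_span_pair.1 ((hD.span_pair_eq hk₁ hk₂ hk).ge hhD)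
  have hrange {c z : K} {k : K →ₗ[F] K} (hc : LinearIndependent F ![1, c])
      (hcq : c ^ (Nat.card F ^ 2) = c) (hr : k.range = Submodule.span F {1, c}) :
      a * k z ∈ k.range := by
    have hz : k z ∈ k.range := ⟨z, rfl⟩
    rw [hr, mem_span_pair_iff_pow_eq hc hcq] at hz ⊢
    rw [mul_pow, haq, hz]
  obtain ⟨y, hy₁, hy₂⟩ := exists_apply_eq_and_apply_eq hdisj (by rw [hr₁, hr₂]; omega)
    (hrange (z := x) ha haq hr₁) (hrange (z := x) hb hbq hr₂)
  have hy : y ∈ (α • k₁ + β • k₂).ker := by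
    change α * k₁ y + β * k₂ y = 0
    rw [hy₁, hy₂, mul_left_comm α, mul_left_comm β, ← mul_add]
    exact mul_eq_zero_of_right a hx
  obtain ⟨s, rfl⟩ := exists_smul_of_finrank_ker_le_one hh.le hx0 hx hy
  have hsa : algebraMap F K s - a ≠ 0 := fun h =>
    notMem_range_of_linearIndependent ha ⟨s, sub_eq_zero.1 h⟩
  have hzero {k : K →ₗ[F] K} (h : k (s • x) = a * k x) : k x = 0 := by
    rw [map_smul, Algebra.smul_def, ← sub_eq_zero, ← sub_mul] at h
    exact (mul_eq_zero.1 h).resolve_left hsa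
  exact hx0 (Submodule.disjoint_def.1 hdisj x (hzero hy₁) (hzero hy₂))

lemma IsPencilOf.exists_isRankFourForm_of_finrank_range_eq_two [Finite F] [FiniteDimensional F K]
    (hD : IsPencilOf D C) (h4 : finrank F K = 4)
    (hker : ∃ h ∈ D, finrank F h.ker = 1) (hk₁ : k₁ ∈ D) (hk₂ : k₂ ∈ D)
    (hk : LinearIndependent K ![k₁, k₂]) (hr₁ : finrank F k₁.range = 2)
    (hr₂ : finrank F k₂.range = 2) :
    ∃ f : K →ₗ[F] K, IsRankFourForm f ∧ IsRepresentedBy F C f := by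
  obtain ⟨c, a, hc, ha, hca⟩ := exists_map_mulLeft_eq_span_one hr₁
  obtain ⟨d, b, hd, hb, hdb⟩ := exists_map_mulLeft_eq_span_one hr₂
  rw [← range_smul_eq_map_mulLeft] at hca hdb
  have hk' : LinearIndependent K ![c • k₁, d • k₂] := linearIndependent_smul_pair hc hd hk
  obtain ⟨ω, f, hf, hC⟩ := hD.exists_isDualBasisForm h4 (D.smul_mem c hk₁) (D.smul_mem d hk₂)
    hk' ha hb hca hdb
  have hnot := hD.not_pow_eq_and_pow_eq h4 hker (D.smul_mem c hk₁) (D.smul_mem d hk₂)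
    hk' ha hb hca hdb
  exact ⟨f, .inr (.inr (.inr (.inr ⟨a, b, ω, hnot, hf⟩))), hC⟩

end TwoPoints

section RankFourClubs

variable {F K : Type*} [Field F] [Field K] [Algebra F K] {f : K →ₗ[F] K} {b : K}

lemma linearIndependent_of_apply_eq_zero {u₀ u₁ u₂ u₃ : K} (h₀ : f u₀ = 0) (h₁ : f u₁ = 0)
    (hu : LinearIndependent F ![u₀, u₁]) (hfu : LinearIndependent F ![f u₂, f u₃]) :
    LinearIndependent F ![u₀, u₁, u₂, u₃] := by
  have hzero {s t : F} (h : f (s • u₂ + t • u₃) = 0) : s = 0 ∧ t = 0 := by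
    rw [map_add, map_smul, map_smul] at h
    exact LinearIndependent.pair_iff.1 hfu s t h
  refine linearIndependent_of_disjoint hu (LinearIndependent.pair_iff.2 fun s t h => hzero ?_) ?_
  · rw [h, map_zero]
  · have hle : Submodule.span F {u₀, u₁} ≤ f.ker := by
      rw [Submodule.span_le, Set.pair_subset_iff]
      exact ⟨h₀, h₁⟩
    rw [Submodule.disjoint_def]
    intro x hx hx'
    obtain ⟨s, t, rfl⟩ := Submodule.mem_span_pair.1 hx'
    obtain ⟨rfl, rfl⟩ := hzero (hle hx)
    rw [zero_smul, zero_smul, add_zero]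

lemma span_range_pow_eq_top [FiniteDimensional F K] (hb : F⟮b⟯ = ⊤) :
    Submodule.span F (Set.range fun i : Fin (finrank F K) => b ^ (i : ℕ)) = ⊤ := by
  have hdeg : (minpoly F b).natDegree = finrank F K := by
    rw [← adjoin.finrank (Algebra.IsIntegral.isIntegral b), hb, IntermediateField.finrank_top']
  have h := linearIndependent_pow (K := F) b
  rw [hdeg] at h
  have : Nonempty (Fin (finrank F K)) := Fin.pos_iff_nonempty.1 finrank_pos
  exact h.span_eq_top_of_card_eq_finrank (Fintype.card_fin _)

lemma IsThinOutsideKer.exists_apply_eq_one [FiniteDimensional F K] (hf : IsThinOutsideKer f)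
    (h4 : finrank F K = 4) (hb : LinearIndependent F ![1, b])
    (hr : f.range = Submodule.span F {1, b}) (hb4 : F⟮b⟯ = ⊤) {c : K} (hc0 : c ≠ 0)
    (hc : f c = 0) (hcb : f (c * b) = 0) :
    ∃ (r : F) (x : K), r ≠ 0 ∧ f x = 1 ∧ f ((x - r • c * b ^ 2) * b) = b := by
  obtain ⟨x₁, hx₁⟩ : (1 : K) ∈ f.range := hr ▸ Submodule.mem_span_pair.2 ⟨1, 0, by simp⟩
  obtain ⟨x₂, hx₂⟩ : b ∈ f.range := hr ▸ Submodule.mem_span_pair.2 ⟨0, 1, by simp⟩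
  have hspan := span_range_pow_eq_top hb4
  rw [h4] at hspan
  obtain ⟨z, hz⟩ := (Submodule.mem_span_range_iff_exists_fun F).1
    (hspan ▸ Submodule.mem_top : (x₂ - b * x₁) / c ∈ _)
  rw [Fin.sum_univ_four, eq_div_iff hc0] at hz
  replace hz : (z 0 • b ^ 0 + z 1 • b ^ 1 + z 2 • b ^ 2 + z 3 • b ^ 3) * c = x₂ - b * x₁ := hz
  have hlin (s t : F) : f (s • c + t • (c * b)) = 0 := by
    rw [map_add, map_smul, map_smul, hc, hcb, smul_zero, smul_zero, add_zero]
  refine ⟨-z 3, x₁ + z 2 • (c * b), ?_, ?_, ?_⟩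
  · rw [Ne, neg_eq_zero]
    intro hz3
    refine hf.sub_mul_ne hb hx₁ hx₂ (hlin (z 0) (z 1)) (hlin 0 (z 2)) ?_
    rw [← hz, hz3]
    simp only [Algebra.smul_def, map_zero]
    ring
  · rw [map_add, map_smul, hcb, smul_zero, add_zero, hx₁]
  · have hx : (x₁ + z 2 • (c * b) - -z 3 • c * b ^ 2) * b = x₂ - (z 0 • c + z 1 • (c * b)) := by
      simp only [Algebra.smul_def, map_neg] at hz ⊢
      linear_combination hz
    rw [hx, map_sub, hlin, sub_zero, hx₂]

variable {C : Submodule K (Fin (4 + 1) → K)} {D : Submodule K (K →ₗ[F] K)}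

lemma IsPencilOf.exists_isDualBasisForm_of_isThinOutsideKer [FiniteDimensional F K]
    [Algebra.IsSeparable F K] (hD : IsPencilOf D C) (hfD : f ∈ D)
    (hli : LinearIndependent K ![LinearMap.id, f]) (hf : IsThinOutsideKer f)
    (h4 : finrank F K = 4) (hb : LinearIndependent F ![1, b])
    (hr : f.range = Submodule.span F {1, b}) (hb4 : F⟮b⟯ = ⊤) {c : K} (hc0 : c ≠ 0)
    (hc : f c = 0) (hcb : f (c * b) = 0) :
    ∃ (g : K →ₗ[F] K) (ω : K), IsDualBasisForm ![1, b, b ^ 2 + ω, ω * b] b g ∧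
      IsRepresentedBy F C g := by
  obtain ⟨r, x, hr0, hx, hxb⟩ := hf.exists_apply_eq_one h4 hb hr hb4 hc0 hc hcb
  have hρ : r • c ≠ 0 := smul_ne_zero hr0 hc0
  let g : K →ₗ[F] K := f ∘ₗ LinearMap.mulLeft F (r • c)
  have hg (y : K) : g y = f (r • c * y) := rfl
  let ω := (r • c)⁻¹ * x - b ^ 2
  have h0 : g 1 = 0 := by rw [hg, mul_one, map_smul, hc, smul_zero]
  have h1 : g b = 0 := by rw [hg, smul_mul_assoc, map_smul, hcb, smul_zero]
  have h2 : g (b ^ 2 + ω) = 1 := by rw [hg, add_sub_cancel, mul_inv_cancel_left₀ hρ, hx]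
  have h3 : g (ω * b) = b := by
    rw [hg, ← mul_assoc, mul_sub, mul_inv_cancel_left₀ hρ, hxb]
  refine ⟨g, ω, isDualBasisForm_of_apply h4
    (linearIndependent_of_apply_eq_zero h0 h1 hb (by rwa [h2, h3])) h0 h1 h2 h3, ?_⟩
  have hli' : LinearIndependent K ![(r • c)⁻¹ • LinearMap.id, (1 : K) • f] :=
    linearIndependent_smul_pair (inv_ne_zero hρ) one_ne_zero hli
  rw [one_smul] at hli'
  exact hD.isRepresentedBy (D.smul_mem _ hD.id_mem) hfD hli' (mul_right_injective₀ (inv_ne_zero hρ))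
    fun y => congrArg f (mul_inv_cancel_left₀ hρ y)

section Finite

variable [Finite F]

variable (F K) in
/-- The `q`-polynomial `x ^ q - x ^ (q ^ 3)`. -/
noncomputable def frobSubCube : K →ₗ[F] K :=
  (frob F).toLinearMap - (frob F ^ 3).toLinearMap

lemma frobSubCube_apply (x : K) :
    frobSubCube F K x = x ^ Nat.card F - x ^ (Nat.card F ^ 3) := by
  rw [← frob_apply, ← frob_pow_apply]
  rfl

lemma frobSubCube_eq_zero_iff {x : K} :
    frobSubCube F K x = 0 ↔ x ^ (Nat.card F ^ 2) = x := by
  rw [frobSubCube_apply, sub_eq_zero, pow_succ, pow_mul, ← frob_apply, ← frob_apply, eq_comm]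
  exact (frob_injective F).eq_iff

lemma frobSubCube_pow_mul (hb : b ^ (Nat.card F ^ 2) = b) (x : K) :
    frobSubCube F K (b ^ Nat.card F * x) = b * frobSubCube F K x := by
  have hb4 : (b ^ Nat.card F) ^ (Nat.card F ^ 3) = b := by
    rw [← pow_mul, ← pow_succ', pow_add _ 2 2, pow_mul, hb, hb]
  rw [frobSubCube_apply, frobSubCube_apply, mul_pow, mul_pow, hb4, ← pow_mul, ← pow_two, hb,
    mul_sub]

lemma pow_card_sq_eq_of_finrank_adjoin_eq_two (hb : finrank F F⟮b⟯ = 2) :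
    b ^ (Nat.card F ^ 2) = b := by
  have : FiniteDimensional F F⟮b⟯ := Module.finite_of_finrank_pos (by omega)
  have h := congrArg (algebraMap F⟮b⟯ K) (pow_card_pow_finrank F (AdjoinSimple.gen F b))
  rwa [hb, map_pow, AdjoinSimple.algebraMap_gen] at h

variable [FiniteDimensional F K]

lemma apply_eq_zero_iff_div_pow_eq (hb : LinearIndependent F ![1, b])
    (hbq : b ^ (Nat.card F ^ 2) = b) (hdim : finrank F f.ker = 2) {c : K} (hc0 : c ≠ 0)
    (hc : f c = 0) (hcb : f (c * b) = 0) (x : K) :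
    f x = 0 ↔ (x / c) ^ (Nat.card F ^ 2) = x / c := by
  have hker : (Submodule.span F {1, b}).map (LinearMap.mulLeft F c) = f.ker := by
    refine Submodule.eq_of_le_of_finrank_eq ?_ ?_
    · rw [map_mulLeft_span_pair, mul_one, Submodule.span_le, Set.pair_subset_iff]
      exact ⟨hc, hcb⟩
    · rw [finrank_map_mulLeft hc0, linearIndependent_pair_iff_finrank_span.1 hb, hdim]
  rw [← mem_span_pair_iff_pow_eq hb hbq, ← LinearMap.mem_ker, ← hker]
  refine ⟨?_, fun h => ⟨x / c, h, mul_div_cancel₀ _ hc0⟩⟩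
  rintro ⟨y, hy, rfl⟩
  rwa [LinearMap.mulLeft_apply, mul_div_cancel_left₀ _ hc0]

omit [FiniteDimensional F K] [Finite F] in
lemma apply_eq_mul_apply_of_ker_le {g : K →ₗ[F] K} (hr : f.range = Submodule.span F {1, b})
    (hle : f.ker ≤ g.ker) {κ x₁ x₂ : K} (hx₁ : f x₁ = 1) (hx₂ : f x₂ = b) (hg₁ : g x₁ = κ)
    (hg₂ : g x₂ = κ * b) (x : K) : g x = κ * f x := by
  obtain ⟨s, t, hst⟩ := Submodule.mem_span_pair.1 (hr.le ⟨x, rfl⟩)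
  have hker : x - (s • x₁ + t • x₂) ∈ f.ker := by
    rw [LinearMap.mem_ker, map_sub, map_add, map_smul, map_smul, hx₁, hx₂, hst, sub_self]
  have h := hle hker
  rw [LinearMap.mem_ker, map_sub, sub_eq_zero, map_add, map_smul, map_smul, hg₁, hg₂] at h
  rw [h, ← hst, mul_add, mul_smul_comm, mul_smul_comm, mul_one]

omit [FiniteDimensional F K] in
lemma IsThinOutsideKer.frobSubCube_ne_zero (hf : IsThinOutsideKer f)
    (hb : LinearIndependent F ![1, b]) (hbq : b ^ (Nat.card F ^ 2) = b) {c m x₁ x₂ : K}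
    (hc : ∀ x, x ^ (Nat.card F ^ 2) = x → f (c * x) = 0) (hx₁ : f x₁ = 1) (hx₂ : f x₂ = b)
    {X : K} (hX₁ : c * X = x₁ + m) (hX₂ : c * (b ^ Nat.card F * X) = x₂ + m * b) :
    frobSubCube F K X ≠ 0 := by
  intro h
  have hXq := frobSubCube_eq_zero_iff.1 h
  have hbXq : ((b ^ Nat.card F - b) * X) ^ (Nat.card F ^ 2) = (b ^ Nat.card F - b) * X := by
    have hbq' : (b ^ Nat.card F) ^ (Nat.card F ^ 2) = b ^ Nat.card F := by
      rw [← pow_mul, mul_comm, pow_mul, hbq]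
    rw [mul_pow, hXq, mem_eqLocus_frob_pow.1
      (Submodule.sub_mem _ (mem_eqLocus_frob_pow.2 hbq') (mem_eqLocus_frob_pow.2 hbq))]
  refine hf.sub_mul_ne hb hx₁ hx₂ (hc _ hbXq) (map_zero f) ?_
  linear_combination b * hX₁ - hX₂

omit [Finite F] in
lemma IsPencilOf.isRepresentedBy_of_apply_eq (hD : IsPencilOf D C) (hfD : f ∈ D)
    (hli : LinearIndependent K ![LinearMap.id, f]) {g : K →ₗ[F] K} {c m κ : K} (hc : c ≠ 0)
    (hκ : κ ≠ 0) (hg : ∀ x, g (c * (x + m * f x)) = κ * f x) : IsRepresentedBy F C g := by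
  let u : K →ₗ[F] K := c • (LinearMap.id + m • f)
  have hinj : Function.Injective u := by
    rw [← LinearMap.ker_eq_bot, LinearMap.ker_eq_bot']
    intro x hx
    replace hx : c * (x + m * f x) = 0 := hx
    have hfx := hg x
    rw [hx, map_zero, eq_comm, mul_eq_zero, or_iff_right hκ] at hfx
    rwa [hfx, mul_zero, add_zero, mul_eq_zero, or_iff_right hc] at hx
  have hli' : LinearIndependent K ![u, κ • f] :=
    linearIndependent_smul_pair hc hκ ((LinearIndependent.pair_add_smul_left_iff m).2 hli)
  exact hD.isRepresentedBy (D.smul_mem _ (D.add_mem hD.id_mem (D.smul_mem m hfD)))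
    (D.smul_mem κ hfD) hli' hinj hg

lemma IsPencilOf.isRepresentedBy_frobSubCube (hD : IsPencilOf D C) (hfD : f ∈ D)
    (hli : LinearIndependent K ![LinearMap.id, f]) (hf : IsThinOutsideKer f)
    (h4 : finrank F K = 4) (hb : LinearIndependent F ![1, b])
    (hr : f.range = Submodule.span F {1, b}) (hbq : b ^ (Nat.card F ^ 2) = b) {c : K}
    (hc0 : c ≠ 0) (hc : f c = 0) (hcb : f (c * b) = 0) :
    IsRepresentedBy F C (frobSubCube F K) := by
  have hker := finrank_ker_add_two hb hr
  have hmem := apply_eq_zero_iff_div_pow_eq hb hbq (by omega) hc0 hc hcb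
  obtain ⟨x₁, hx₁⟩ : (1 : K) ∈ f.range := hr ▸ Submodule.mem_span_pair.2 ⟨1, 0, by simp⟩
  obtain ⟨x₂, hx₂⟩ : b ∈ f.range := hr ▸ Submodule.mem_span_pair.2 ⟨0, 1, by simp⟩
  obtain ⟨m, hm⟩ : ∃ m, b ^ Nat.card F * (x₁ + m) = x₂ + m * b := by
    have hbne : b - b ^ Nat.card F ≠ 0 := fun h => notMem_range_of_linearIndependent hb
      (mem_range_algebraMap_of_pow_card_eq (sub_eq_zero.1 h).symm)
    refine ⟨(b ^ Nat.card F * x₁ - x₂) / (b - b ^ Nat.card F), ?_⟩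
    field_simp
    ring
  let u : K →ₗ[F] K := c⁻¹ • (LinearMap.id + m • f)
  have hu (x : K) : u x = c⁻¹ * (x + m * f x) := rfl
  let κ := frobSubCube F K (u x₁)
  have hu₂ : u x₂ = b ^ Nat.card F * u x₁ := by
    rw [hu, hu, hx₁, hx₂, mul_one, ← hm]
    ring
  have hκ : κ ≠ 0 := by
    refine hf.frobSubCube_ne_zero hb hbq (c := c) (m := m) (fun x hx => ?_) hx₁ hx₂ ?_ ?_
    · rwa [hmem, mul_div_cancel_left₀ _ hc0]
    · rw [hu, hx₁, mul_one, mul_inv_cancel_left₀ hc0]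
    · rw [← hu₂, hu, hx₂, mul_inv_cancel_left₀ hc0]
  have hle : f.ker ≤ (frobSubCube F K ∘ₗ u).ker := fun y hy => by
    rw [LinearMap.mem_ker, LinearMap.comp_apply, frobSubCube_eq_zero_iff, hu,
      LinearMap.mem_ker.1 hy, mul_zero, add_zero, inv_mul_eq_div]
    exact (hmem y).1 hy
  have hκf (x : K) : frobSubCube F K (u x) = κ * f x := by
    refine apply_eq_mul_apply_of_ker_le hr hle hx₁ hx₂ rfl ?_ x
    exact (congrArg (frobSubCube F K) hu₂).trans ((frobSubCube_pow_mul hbq _).trans (mul_comm _ _))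
  exact hD.isRepresentedBy_of_apply_eq hfD hli (inv_ne_zero hc0) hκ hκf

lemma IsPencilOf.exists_isRankFourForm_of_isThinOutsideKer (hD : IsPencilOf D C)
    (hfD : f ∈ D) (hli : LinearIndependent K ![LinearMap.id, f])
    (hf : IsThinOutsideKer f) (h4 : finrank F K = 4) (hb : LinearIndependent F ![1, b])
    (hr : f.range = Submodule.span F {1, b}) :
    ∃ g : K →ₗ[F] K, IsRankFourForm g ∧ IsRepresentedBy F C g := by
  have ht := two_le_finrank_adjoin (notMem_range_of_linearIndependent hb)
  have hker := finrank_ker_add_two hb hr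
  obtain ⟨θ, hθ0, hθ⟩ := hf.exists_mem_ker_iff_trace hb hr
  obtain ⟨c, S, hc0, hdim, -, hS⟩ := exists_eq_sup_span_mul_pow hθ0 ht hker hθ
  have hcases : finrank F F⟮b⟯ = 2 ∨ finrank F F⟮b⟯ = 4 := by
    rw [h4] at hdim
    have hle := Nat.le_of_dvd (by norm_num) (Dvd.intro _ hdim)
    interval_cases finrank F F⟮b⟯ <;> omega
  rcases hcases with h2 | hb4
  · rw [h2, Nat.sub_self, ← bot_eq_zero, Set.Iio_bot, Set.image_empty, Submodule.span_empty,
      sup_bot_eq] at hS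
    obtain ⟨c, hc, hc0⟩ := Submodule.exists_mem_ne_zero_of_ne_bot
      (Submodule.one_le_finrank_iff.1 (by omega : 1 ≤ finrank F f.ker))
    have hcb : f (c * b) = 0 := by
      rw [← LinearMap.mem_ker, hS, mul_comm] at *
      exact S.smul_mem (AdjoinSimple.gen F b) hc
    refine ⟨_, .inr (.inr (.inl frobSubCube_apply)), hD.isRepresentedBy_frobSubCube hfD hli hf h4 hb
      hr (pow_card_sq_eq_of_finrank_adjoin_eq_two h2) hc0 hc hcb⟩
  · have hmem (i : ℕ) (hi : i < 2) : f (c * b ^ i) = 0 := by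
      rw [← LinearMap.mem_ker, hS, hb4]
      exact Submodule.mem_sup_right (Submodule.subset_span ⟨i, hi, rfl⟩)
    have htop : F⟮b⟯ = ⊤ :=
      eq_of_le_of_finrank_eq le_top (by rw [hb4, IntermediateField.finrank_top', h4])
    obtain ⟨g, ω, hg, hgC⟩ := hD.exists_isDualBasisForm_of_isThinOutsideKer hfD hli hf h4 hb hr
      htop hc0 (by simpa using hmem 0 two_pos) (by simpa using hmem 1 one_lt_two)
    exact ⟨g, .inr (.inr (.inr (.inl ⟨b, ω, htop, hg⟩))), hgC⟩

end Finite

end RankFourClubs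

section FiniteFields

variable {F : Type*} [Field F] [Finite F]

lemma exists_ne_zero_eval_eq_zero {σ : Type*} [Fintype σ] {P : MvPolynomial σ F}
    (hP : P.totalDegree < Fintype.card σ) (h0 : MvPolynomial.eval 0 P = 0) :
    ∃ s ≠ 0, MvPolynomial.eval s P = 0 := by
  classical
  let := Fintype.ofFinite F
  obtain ⟨p, _⟩ := CharP.exists F
  by_contra! h
  have hcard : Fintype.card {s : σ → F // MvPolynomial.eval s P = 0} = 1 :=
    Fintype.card_eq_one_iff.2 ⟨⟨0, h0⟩, fun s => Subtype.ext (by_contra fun hs => h s hs s.2)⟩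
  have hdvd := char_dvd_card_solutions p hP
  rw [hcard] at hdvd
  exact (CharP.char_is_prime F p).one_lt.ne' (Nat.dvd_one.1 hdvd)

lemma exists_ne_zero_bilinForm_self_eq_zero {V : Type*} [AddCommGroup V] [Module F V]
    (hV : 2 < finrank F V) (B : LinearMap.BilinForm F V) : ∃ x ≠ 0, B x x = 0 := by
  have : FiniteDimensional F V := Module.finite_of_finrank_pos (by omega)
  let ξ := finBasis F V
  let P : MvPolynomial (Fin (finrank F V)) F := ∑ i, ∑ j,
    MvPolynomial.C (B (ξ i) (ξ j)) * (MvPolynomial.X i * MvPolynomial.X j)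
  have hdeg : P.totalDegree ≤ 2 := by
    refine MvPolynomial.IsHomogeneous.totalDegree_le
      (.sum _ _ _ fun i _ => .sum _ _ _ fun j _ => ?_)
    exact ((MvPolynomial.isHomogeneous_X F i).mul (MvPolynomial.isHomogeneous_X F j)).C_mul _
  have heval (s : Fin (finrank F V) → F) :
      MvPolynomial.eval s P = B (∑ i, s i • ξ i) (∑ i, s i • ξ i) := by
    simp only [P, map_sum, map_mul, MvPolynomial.eval_C, MvPolynomial.eval_X, LinearMap.sum_apply,
      map_smul, LinearMap.smul_apply, smul_eq_mul, Finset.mul_sum]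
    rw [Finset.sum_comm]
    exact Finset.sum_congr rfl fun i _ => Finset.sum_congr rfl fun j _ => by ring
  obtain ⟨s, hs0, hs⟩ := exists_ne_zero_eval_eq_zero (P := P)
    (hdeg.trans_lt (by rwa [Fintype.card_fin])) ((heval 0).trans (by simp))
  refine ⟨∑ i, s i • ξ i, fun h => hs0 ?_, by rw [← heval, hs]⟩
  exact funext (Fintype.linearIndependent_iff.1 ξ.linearIndependent s h)

variable {K : Type*} [Field K] [Algebra F K]

lemma exists_ne_zero_trace_mul_eq_zero (hK : 2 < finrank F K) (w : K) :
    ∃ x : K, x ≠ 0 ∧ Algebra.trace F K (w * (x * x ^ Nat.card F)) = 0 := by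
  obtain ⟨x, hx, h⟩ := exists_ne_zero_bilinForm_self_eq_zero hK
    ((Algebra.traceForm F K).compl₁₂ (LinearMap.mulLeft F w) (frob F : K →ₐ[F] K).toLinearMap)
  refine ⟨x, hx, ?_⟩
  rwa [← mul_assoc, ← frob_apply]

variable [FiniteDimensional F K]

lemma exists_pow_card_sub_eq {x : K} (hx : Algebra.trace F K x = 0) :
    ∃ z : K, z ^ Nat.card F - z = x := by
  have : Finite K := Module.finite_of_finite F
  let e : K ≃ₐ[F] K :=
    AlgEquiv.ofBijective (frob F) (Finite.injective_iff_bijective.1 (frob_injective F))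
  let φ : K →ₗ[F] K := (frob F ^ 1 : K →ₐ[F] K).toLinearMap
  have hle : (φ - LinearMap.id).range ≤ (Algebra.trace F K).ker := by
    rintro _ ⟨z, rfl⟩
    rw [LinearMap.mem_ker, LinearMap.sub_apply, map_sub, sub_eq_zero]
    exact Algebra.trace_eq_of_algEquiv e z
  have hker : finrank F (φ - LinearMap.id).ker ≤ 1 := by
    rw [← LinearMap.eqLocus_eq_ker_sub]
    exact finrank_eqLocus_frob_pow_le one_ne_zero
  have hφ := (φ - LinearMap.id).finrank_range_add_finrank_ker
  have htr := (Algebra.trace F K).finrank_range_add_finrank_ker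
  rw [LinearMap.range_eq_top.2 (Algebra.trace_surjective F K), finrank_top, finrank_self] at htr
  obtain ⟨z, rfl⟩ := (Submodule.eq_of_le_of_finrank_le hle (by omega)).ge hx
  exact ⟨z, by rw [← frob_apply]; rfl⟩

omit [Finite F] in
lemma exists_pow_eq_of_pow_eq_one {G : Type*} [CommGroup G] [IsCyclic G] [Finite G] {m s : ℕ}
    (hG : Nat.card G = m * s) {x : G} (hx : x ^ s = 1) : ∃ y, y ^ m = x := by
  have hms : 0 < m * s := hG ▸ Nat.card_pos
  have hle : (powMonoidHom m : G →* G).range ≤ (powMonoidHom s).ker := by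
    rintro _ ⟨y, rfl⟩
    rw [MonoidHom.mem_ker, powMonoidHom_apply, powMonoidHom_apply, ← pow_mul, ← hG,
      pow_card_eq_one']
  have hcard :
      Nat.card (powMonoidHom m : G →* G).range = Nat.card (powMonoidHom s : G →* G).ker := by
    rw [IsCyclic.card_powMonoidHom_range, IsCyclic.card_powMonoidHom_ker, hG,
      Nat.gcd_mul_right_left, Nat.gcd_mul_left_left,
      Nat.mul_div_cancel_left _ (Nat.pos_of_mul_pos_right hms)]
  exact (Subgroup.eq_of_le_of_card_ge hle hcard.ge).ge hx

/-- Mathlib's Hilbert 90, `groupCohomology.exists_div_of_norm_eq_one`, needs both fields in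
`Type`. -/
lemma exists_pow_card_eq_mul {δ : K} (hδ : Algebra.norm F δ = 1) :
    ∃ y : K, y ≠ 0 ∧ y ^ Nat.card F = δ * y := by
  have : Finite K := Module.finite_of_finite F
  have hδ0 : δ ≠ 0 := by
    rintro rfl
    simp at hδ
  have hpow := FiniteField.algebraMap_norm_eq_pow_sum F K δ
  rw [hδ, map_one] at hpow
  have hcard : Nat.card Kˣ =
      (Nat.card F - 1) * ∑ i ∈ Finset.range (finrank F K), Nat.card F ^ i := by
    rw [Nat.card_units, Module.natCard_eq_pow_finrank (K := F), mul_comm,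
      geom_sum_mul_of_one_le Nat.card_pos]
  obtain ⟨y, hy⟩ := exists_pow_eq_of_pow_eq_one hcard (x := Units.mk0 δ hδ0)
    (Units.ext hpow.symm)
  refine ⟨y, y.ne_zero, ?_⟩
  rw [← Nat.sub_add_cancel (Finite.one_lt_card (α := F)).le, pow_succ]
  exact congrArg (fun z : Kˣ => (z * y : K)) hy

lemma exists_mul_pow_card_sub_eq (hK : 2 < finrank F K) {w : K} (hw : w ≠ 0) :
    ∃ x y : K, LinearIndependent F ![x, y] ∧ x * y ^ Nat.card F - x ^ Nat.card F * y = w := by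
  obtain ⟨u, hu0, hu⟩ := exists_ne_zero_trace_mul_eq_zero hK w
  obtain ⟨z, hz⟩ := exists_pow_card_sub_eq hu
  have huq : u ^ Nat.card F ≠ 0 := pow_ne_zero _ hu0
  refine ⟨u⁻¹, u⁻¹ * z, (LinearIndependent.pair_iff' (inv_ne_zero hu0)).2 fun s hs => ?_, ?_⟩
  · have hzs : algebraMap F K s = z := by
      rw [Algebra.smul_def, mul_comm] at hs
      exact mul_left_cancel₀ (inv_ne_zero hu0) hs
    rw [← frob_apply, ← hzs, AlgHom.commutes, sub_self] at hz
    exact mul_ne_zero hw (mul_ne_zero hu0 huq) hz.symm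
  · calc u⁻¹ * (u⁻¹ * z) ^ Nat.card F - u⁻¹ ^ Nat.card F * (u⁻¹ * z)
        = u⁻¹ * u⁻¹ ^ Nat.card F * (z ^ Nat.card F - z) := by
          rw [mul_pow]
          ring
      _ = w := by
          rw [hz, inv_pow]
          field_simp

lemma exists_pair_of_norm_eq_one {n : ℕ} (hn : 2 ≤ n) (hK : finrank F K = n + 1) {δ : K}
    (hδ : Algebra.norm F δ = 1) :
    ∃ x y : K, LinearIndependent F ![x, y] ∧
      x * (y ^ Nat.card F + δ * y ^ (Nat.card F ^ n)) =
        y * (x ^ Nat.card F + δ * x ^ (Nat.card F ^ n)) := by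
  have hfix (x : K) : (x ^ Nat.card F) ^ (Nat.card F ^ n) = x := by
    rw [← pow_mul, ← pow_succ', ← hK, pow_card_pow_finrank]
  obtain ⟨w, hw0, hw⟩ : ∃ w : K, w ≠ 0 ∧ δ * w ^ (Nat.card F ^ n) = w := by
    obtain ⟨y, hy0, hyq⟩ := exists_pow_card_eq_mul hδ
    exact ⟨y ^ Nat.card F, pow_ne_zero _ hy0, by rw [hfix, hyq]⟩
  obtain ⟨x, y, hxy, hxyw⟩ := exists_mul_pow_card_sub_eq (F := F) (by omega) hw0
  have hwn : w ^ (Nat.card F ^ n) = x ^ (Nat.card F ^ n) * y - x * y ^ (Nat.card F ^ n) := by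
    rw [← hxyw, ← frob_pow_apply, map_sub, frob_pow_apply, frob_pow_apply, mul_pow, mul_pow, hfix,
      hfix]
  rw [hwn] at hw
  exact ⟨x, y, hxy, by linear_combination hxyw - hw⟩

open Polynomial in
lemma exists_aeval_eq_zero_of_natDegree_dvd_finrank {g : F[X]} (hg : Irreducible g)
    (hdvd : g.natDegree ∣ finrank F K) : ∃ x : K, aeval x g = 0 := by
  have : Finite K := Module.finite_of_finite F
  let := Fintype.ofFinite K
  have hcard : Nat.card F ^ finrank F K = Fintype.card K := by
    rw [← Module.natCard_eq_pow_finrank, Fintype.card_eq_nat_card]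
  have h := hg.natDegree_dvd_iff_dvd_X_pow_card_pow_sub_X.1 hdvd
  rw [hcard] at h
  have hsplits := (FiniteField.isSplittingField_sub K F).splits.of_dvd (Polynomial.map_ne_zero
    (FiniteField.X_pow_card_sub_X_ne_zero F Fintype.one_lt_card))
    (Polynomial.map_dvd (algebraMap F K) h)
  obtain ⟨x, hx⟩ := hsplits.exists_eval_eq_zero (by
    rw [degree_map]
    exact (natDegree_pos_iff_degree_pos.1 hg.natDegree_pos).ne')
  exact ⟨x, by rwa [aeval_def, ← eval_map]⟩

open Polynomial in
lemma exists_aeval_eq_zero_of_natDegree_eq_two (hK : 2 ∣ finrank F K) {P : F[X]}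
    (hP : P.natDegree = 2) : ∃ x : K, aeval x P = 0 ∧ x ^ (Nat.card F ^ 2) = x := by
  obtain ⟨g, hg, hgP⟩ := exists_irreducible_of_natDegree_ne_zero (f := P) (by omega)
  have hg2 : g.natDegree ∣ 2 := by
    have hle := natDegree_le_of_dvd hgP (ne_zero_of_natDegree_gt (hP ▸ zero_lt_two))
    have hpos := hg.natDegree_pos
    rw [hP] at hle
    interval_cases g.natDegree <;> norm_num
  obtain ⟨x, hx⟩ := exists_aeval_eq_zero_of_natDegree_dvd_finrank (K := K) hg (hg2.trans hK)
  refine ⟨x, aeval_eq_zero_of_dvd_aeval_eq_zero hgP hx, ?_⟩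
  have h := aeval_eq_zero_of_dvd_aeval_eq_zero
    (hg.natDegree_dvd_iff_dvd_X_pow_card_pow_sub_X.1 hg2) hx
  rwa [map_sub, map_pow, aeval_X, sub_eq_zero] at h

end FiniteFields

section AlternatingForms

lemma two_le_rank_of_apply_ne_zero {k m : Type*} [Field k] [Fintype m] {A : Matrix m m k} {i j : m}
    (hii : A i i = 0) (hjj : A j j = 0) (hij : A i j ≠ 0) (hji : A j i ≠ 0) : 2 ≤ A.rank := by
  classical
  have hli : LinearIndependent k ![A.col i, A.col j] := by
    rw [LinearIndependent.pair_iff]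
    intro s t h
    have hi : s * A i i + t * A i j = 0 := congrFun h i
    have hj : s * A j i + t * A j j = 0 := congrFun h j
    rw [hii, mul_zero, zero_add] at hi
    rw [hjj, mul_zero, add_zero] at hj
    exact ⟨(mul_eq_zero.1 hj).resolve_right hji, (mul_eq_zero.1 hi).resolve_right hij⟩
  rw [Matrix.rank, ← linearIndependent_pair_iff_finrank_span.1 hli]
  refine Submodule.finrank_mono (Submodule.span_le.2 (Set.pair_subset_iff.2 ⟨?_, ?_⟩))
  exacts [⟨_, A.mulVec_single_one i⟩, ⟨_, A.mulVec_single_one j⟩]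

section CommRing

variable {R S : Type*} [CommRing R] [CommRing S]

/-- The Pfaffian of `altMatrix t`. -/
def pfaffian (t : Fin 6 → R) : R := t 0 * t 5 - t 1 * t 4 + t 2 * t 3

/-- The alternating `4 × 4` matrix with given entries above the diagonal, these being indexed in
lexicographic order. -/
def altMatrix (t : Fin 6 → R) : Matrix (Fin 4) (Fin 4) R :=
  !![0, t 0, t 1, t 2; -t 0, 0, t 3, t 4; -t 1, -t 3, 0, t 5; -t 2, -t 4, -t 5, 0]

/-- The Plücker coordinates of the line through `x` and `y`, indexed in lexicographic order. -/
def plucker (x y : Fin 4 → R) : Fin 6 → R :=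
  ![x 0 * y 1 - x 1 * y 0, x 0 * y 2 - x 2 * y 0, x 0 * y 3 - x 3 * y 0,
    x 1 * y 2 - x 2 * y 1, x 1 * y 3 - x 3 * y 1, x 2 * y 3 - x 3 * y 2]

lemma dotProduct_altMatrix_mulVec (t : Fin 6 → R) (x y : Fin 4 → R) :
    x ⬝ᵥ (altMatrix t).mulVec y = t ⬝ᵥ plucker x y := by
  simp only [dotProduct, Matrix.mulVec, altMatrix, plucker, Fin.sum_univ_four, Fin.sum_univ_six,
    Matrix.of_apply, Matrix.cons_val]
  ring

lemma plucker_self (x : Fin 4 → R) : plucker x x = 0 := by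
  ext l
  fin_cases l <;> simp [plucker, mul_comm]

lemma plucker_swap (x y : Fin 4 → R) : plucker y x = -plucker x y := by
  ext l
  fin_cases l <;> simp [plucker, mul_comm]

lemma map_plucker (σ : R →+* S) (x y : Fin 4 → R) :
    plucker (σ ∘ x) (σ ∘ y) = σ ∘ plucker x y := by
  ext l
  fin_cases l <;> simp [plucker]

lemma map_altMatrix (σ : R →+* S) (t : Fin 6 → R) : (altMatrix t).map σ = altMatrix (σ ∘ t) := by
  ext i j
  fin_cases i <;> fin_cases j <;> simp [altMatrix]

/-- The second factor is the alternating matrix of the Hodge dual form. -/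
lemma altMatrix_mul_altMatrix_dual (t : Fin 6 → R) :
    altMatrix t * altMatrix ![t 5, -t 4, t 3, t 2, -t 1, t 0] = -pfaffian t • 1 := by
  ext i j
  fin_cases i <;> fin_cases j <;>
    simp [altMatrix, pfaffian, Matrix.mul_apply, Fin.sum_univ_four] <;> ring

end CommRing

variable {K : Type*} [Field K] {t : Fin 6 → K}

lemma two_le_rank_altMatrix (ht : t ≠ 0) : 2 ≤ (altMatrix t).rank := by
  obtain ⟨i, j, hij⟩ : ∃ i j, altMatrix t i j ≠ 0 := by
    by_contra! h
    refine ht (funext fun l => ?_)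
    fin_cases l
    exacts [h 0 1, h 0 2, h 0 3, h 1 2, h 1 3, h 2 3]
  have hdiag (i : Fin 4) : altMatrix t i i = 0 := by
    fin_cases i <;> rfl
  have hswap : altMatrix t j i = -altMatrix t i j := by
    fin_cases i <;> fin_cases j <;> simp [altMatrix]
  exact two_le_rank_of_apply_ne_zero (hdiag i) (hdiag j) hij (by rwa [hswap, neg_ne_zero])

lemma rank_altMatrix_of_pfaffian_eq_zero (ht : t ≠ 0) (hpf : pfaffian t = 0) :
    (altMatrix t).rank = 2 := by
  refine le_antisymm ?_ (two_le_rank_altMatrix ht)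
  let s : Fin 6 → K := ![t 5, -t 4, t 3, t 2, -t 1, t 0]
  have hs : s ≠ 0 := by
    contrapose! ht
    refine funext fun l => ?_
    fin_cases l
    exacts [congrFun ht 5, neg_eq_zero.1 (congrFun ht 4), congrFun ht 3, congrFun ht 2,
      neg_eq_zero.1 (congrFun ht 1), congrFun ht 0]
  have hle : (altMatrix s).mulVecLin.range ≤ (altMatrix t).mulVecLin.ker := by
    rw [LinearMap.range_le_ker_iff, ← Matrix.mulVecLin_mul, altMatrix_mul_altMatrix_dual, hpf,
      neg_zero, zero_smul, Matrix.mulVecLin_zero]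
  have hker := Submodule.finrank_mono hle
  have hrank := two_le_rank_altMatrix hs
  have h := (altMatrix t).mulVecLin.finrank_range_add_finrank_ker
  rw [finrank_fin_fun] at h
  rw [Matrix.rank] at hrank ⊢
  omega

lemma finrank_ker_altMatrix (ht : t ≠ 0) (hpf : pfaffian t = 0) :
    finrank K (altMatrix t).mulVecLin.ker = 2 := by
  have h := (altMatrix t).mulVecLin.finrank_range_add_finrank_ker
  have hrank := rank_altMatrix_of_pfaffian_eq_zero ht hpf
  rw [finrank_fin_fun] at h
  rw [Matrix.rank] at hrank
  omega

lemma exists_altMatrix_mulVec_eq_zero (ht : t ≠ 0) (hpf : pfaffian t = 0) {x y : Fin 4 → K}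
    (hxy : t ⬝ᵥ plucker x y = 0) :
    ∃ μ ν : K, (μ ≠ 0 ∨ ν ≠ 0) ∧ (altMatrix t).mulVec (μ • x + ν • y) = 0 := by
  suffices h : ¬ LinearIndependent K ![(altMatrix t).mulVec x, (altMatrix t).mulVec y] by
    simp only [LinearIndependent.pair_iff, not_forall] at h
    obtain ⟨μ, ν, h, hμν⟩ := h
    refine ⟨μ, ν, not_and_or.1 hμν, ?_⟩
    rw [Matrix.mulVec_add, Matrix.mulVec_smul, Matrix.mulVec_smul, h]
  intro h
  have hrank : finrank K (altMatrix t).mulVecLin.range = 2 :=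
    rank_altMatrix_of_pfaffian_eq_zero ht hpf
  have hspan := span_pair_eq_of_finrank_eq_two hrank (LinearMap.mem_range_self _ x)
    (LinearMap.mem_range_self _ y) h
  have horth (z : Fin 4 → K) : x ⬝ᵥ (altMatrix t).mulVec z = 0 := by
    obtain ⟨μ, ν, hz⟩ := Submodule.mem_span_pair.1 (hspan.ge (LinearMap.mem_range_self _ z))
    simp only [Matrix.mulVecLin_apply] at hz
    rw [← hz, dotProduct_add, dotProduct_smul, dotProduct_smul, dotProduct_altMatrix_mulVec,
      dotProduct_altMatrix_mulVec, plucker_self, hxy, dotProduct_zero, smul_zero, smul_zero,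
      add_zero]
  have hx : (altMatrix t).mulVec x = 0 := dotProduct_eq_zero _ fun z => by
    rw [dotProduct_comm, dotProduct_altMatrix_mulVec, plucker_swap, dotProduct_neg,
      ← dotProduct_altMatrix_mulVec, horth, neg_zero]
  exact h.ne_zero 0 hx

section RationalPencils

variable {F : Type*} [Field F] [Finite F] [Algebra F K] [FiniteDimensional F K]

lemma exists_binary_quadratic_eq_zero (hK : 2 ∣ finrank F K) (a b c : F) :
    ∃ μ ν : K, (μ ≠ 0 ∨ ν ≠ 0) ∧ μ ^ (Nat.card F ^ 2) = μ ∧ ν ^ (Nat.card F ^ 2) = ν ∧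
      algebraMap F K a * μ ^ 2 + algebraMap F K b * (μ * ν) + algebraMap F K c * ν ^ 2 = 0 := by
  have hq : Nat.card F ^ 2 ≠ 0 := pow_ne_zero 2 Nat.card_pos.ne'
  by_cases ha : a = 0
  · exact ⟨1, 0, .inl one_ne_zero, one_pow _, zero_pow hq, by simp [ha]⟩
  · obtain ⟨x, hx, hxq⟩ := exists_aeval_eq_zero_of_natDegree_eq_two hK
      (Polynomial.natDegree_quadratic (b := b) (c := c) ha)
    refine ⟨x, 1, .inr one_ne_zero, hxq, one_pow _, ?_⟩
    simpa using hx

lemma exists_mem_span_pfaffian_eq_zero (hK : 2 ∣ finrank F K) {t₁ t₂ : Fin 6 → F}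
    (ht : LinearIndependent F ![t₁, t₂]) :
    ∃ t ∈ Submodule.span K {algebraMap F K ∘ t₁, algebraMap F K ∘ t₂},
      t ≠ 0 ∧ pfaffian t = 0 ∧ ∀ i, t i ^ (Nat.card F ^ 2) = t i := by
  have htK : LinearIndependent K ![algebraMap F K ∘ t₁, algebraMap F K ∘ t₂] := by
    have h := (linearIndependent_algebraMap_comp_iff (S := K)).2 ht
    have hpair : (fun i => algebraMap F K ∘ ![t₁, t₂] i) =
        ![algebraMap F K ∘ t₁, algebraMap F K ∘ t₂] := by
      ext i : 1
      fin_cases i <;> rfl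
    rwa [hpair] at h
  obtain ⟨μ, ν, hμν, hμ, hν, h⟩ := exists_binary_quadratic_eq_zero hK (pfaffian t₁)
    (t₁ 0 * t₂ 5 + t₂ 0 * t₁ 5 - t₁ 1 * t₂ 4 - t₂ 1 * t₁ 4 + t₁ 2 * t₂ 3 + t₂ 2 * t₁ 3)
    (pfaffian t₂)
  refine ⟨_, Submodule.mem_span_pair.2 ⟨μ, ν, rfl⟩, fun h0 => ?_, ?_, fun i => ?_⟩
  · obtain ⟨rfl, rfl⟩ := LinearIndependent.pair_iff.1 htK μ ν h0
    exact hμν.elim (· rfl) (· rfl)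
  · rw [← h]
    simp only [pfaffian, map_add, map_sub, map_mul, Pi.add_apply, Pi.smul_apply, smul_eq_mul,
      Function.comp_apply]
    ring
  · simp only [← frob_pow_apply] at hμ hν ⊢
    simp only [Pi.add_apply, Pi.smul_apply, Function.comp_apply, smul_eq_mul, map_add, map_mul,
      AlgHom.commutes, hμ, hν]

end RationalPencils

end AlternatingForms

section Scattered

variable {F K : Type*} [Field F] [Field K] [Algebra F K] [FiniteDimensional F K]

lemma exists_linearIndependent_pair_of_mem {k V : Type*} [Field k] [AddCommGroup V] [Module k V]
    {W : Submodule k V} (hW : 1 < finrank k W) :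
    ∃ u ∈ W, ∃ v ∈ W, LinearIndependent k ![u, v] := by
  have : Nontrivial W := Module.nontrivial_of_finrank_pos (zero_lt_one.trans hW)
  obtain ⟨u, hu⟩ := exists_ne (0 : W)
  obtain ⟨v, huv⟩ := exists_linearIndependent_pair_of_one_lt_finrank hW hu
  exact ⟨u, u.2, v, v.2, LinearIndependent.pair_iff.2 fun s t h =>
    LinearIndependent.pair_iff.1 huv s t (Subtype.ext h)⟩

variable [Finite F]

lemma linearIndependent_frob_pow_comp {g : K →ₗ[F] K} {m : ℕ} (hg : m ≤ finrank F g.range) :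
    LinearIndependent K fun i : Fin m => (frob F ^ (i : ℕ) : K →ₐ[F] K).toLinearMap ∘ₗ g := by
  rw [Fintype.linearIndependent_iff]
  intro c hc
  by_contra! hne
  obtain ⟨i, hi⟩ := hne
  have hq : 1 < Nat.card F := Finite.one_lt_card
  let P : Polynomial K := ∑ j, Polynomial.C (c j) * Polynomial.X ^ (Nat.card F ^ (j : ℕ))
  have hP : P ≠ 0 := by
    intro h
    have hcoeff := congrArg (Polynomial.coeff · (Nat.card F ^ (i : ℕ))) h
    simp only [P, Polynomial.finsetSum_coeff, Polynomial.coeff_C_mul_X_pow,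
      (Nat.pow_right_injective hq).eq_iff, Fin.val_inj, Finset.sum_ite_eq, Finset.mem_univ,
      if_true, Polynomial.coeff_zero] at hcoeff
    exact hi hcoeff
  have hdeg : P.natDegree ≤ Nat.card F ^ (m - 1) := by
    refine Polynomial.natDegree_sum_le_of_forall_le _ _ fun j _ => ?_
    exact (Polynomial.natDegree_C_mul_X_pow_le _ _).trans
      (Nat.pow_le_pow_right hq.le (Nat.le_sub_one_of_lt j.2))
  have heval : ∀ y ∈ g.range, P.eval y = 0 := by
    rintro _ ⟨x, rfl⟩
    have hx := LinearMap.congr_fun hc x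
    simp only [LinearMap.sum_apply, LinearMap.smul_apply, LinearMap.comp_apply,
      AlgHom.toLinearMap_apply, frob_pow_apply, smul_eq_mul, LinearMap.zero_apply] at hx
    simp only [P, Polynomial.eval_finsetSum, Polynomial.eval_C_mul, Polynomial.eval_X_pow, hx]
  have := finrank_le_of_eval_eq_zero hP hdeg heval
  have := i.2
  omega

lemma exists_isotropic_pfaffian_eq_zero (h4 : finrank F K = 4) (p : Fin 6 → K) :
    ∃ t : Fin 6 → K, t ≠ 0 ∧ pfaffian t = 0 ∧ (∀ i, t i ^ (Nat.card F ^ 2) = t i) ∧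
      t ⬝ᵥ p = 0 ∧ t ⬝ᵥ (frob F ∘ p) = 0 := by
  let L : (Fin 6 → F) →ₗ[F] K := Fintype.linearCombination F p
  have hker : 1 < finrank F L.ker := by
    have h := L.finrank_range_add_finrank_ker
    have hle := L.range.finrank_le
    rw [finrank_fin_fun] at h
    omega
  obtain ⟨t₁, h₁, t₂, h₂, hli⟩ := exists_linearIndependent_pair_of_mem hker
  have hdot {s : Fin 6 → F} (hs : s ∈ L.ker) : (algebraMap F K ∘ s) ⬝ᵥ p = 0 := by
    rw [← LinearMap.mem_ker.1 hs, Fintype.linearCombination_apply]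
    simp only [dotProduct, Function.comp_apply, Algebra.smul_def]
  have hdot_frob {s : Fin 6 → F} (hs : s ∈ L.ker) :
      (algebraMap F K ∘ s) ⬝ᵥ (frob F ∘ p) = 0 := by
    rw [← map_zero (frob F : K →ₐ[F] K), ← hdot hs]
    simp only [dotProduct, Function.comp_apply, map_sum, map_mul, AlgHom.commutes]
  obtain ⟨t, ht, ht0, hpf, htq⟩ :=
    exists_mem_span_pfaffian_eq_zero (K := K) (h4 ▸ by norm_num) hli
  obtain ⟨μ, ν, rfl⟩ := Submodule.mem_span_pair.1 ht
  refine ⟨_, ht0, hpf, htq, ?_, ?_⟩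
  · rw [add_dotProduct, smul_dotProduct, smul_dotProduct, hdot h₁, hdot h₂, smul_zero, smul_zero,
      add_zero]
  · rw [add_dotProduct, smul_dotProduct, smul_dotProduct, hdot_frob h₁, hdot_frob h₂, smul_zero,
      smul_zero, add_zero]

section RadicalMaps

omit [FiniteDimensional F K] [Finite F]

/-- The `F`-linear maps whose values at the basis `ξ` form a vector in the radical of the
alternating form with matrix `altMatrix t`. -/
noncomputable def radicalMaps (ξ : Basis (Fin 4) F K) (t : Fin 6 → K) : Submodule K (K →ₗ[F] K) :=
  (altMatrix t).mulVecLin.ker.map (ξ.constr K).toLinearMap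

variable {ξ : Basis (Fin 4) F K} {t : Fin 6 → K}

lemma mem_radicalMaps {g : K →ₗ[F] K} :
    g ∈ radicalMaps ξ t ↔ (altMatrix t).mulVec (g ∘ ξ) = 0 :=
  Submodule.mem_map_equiv (e := ξ.constr K) _

lemma finrank_radicalMaps (ht : t ≠ 0) (hpf : pfaffian t = 0) :
    finrank K (radicalMaps ξ t) = 2 :=
  (LinearEquiv.finrank_map_eq (ξ.constr K) _).trans (finrank_ker_altMatrix ht hpf)

lemma exists_smul_add_smul_mem_radicalMaps (ht : t ≠ 0) (hpf : pfaffian t = 0)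
    {k₁ k₂ : K →ₗ[F] K} (h : t ⬝ᵥ plucker (k₁ ∘ ξ) (k₂ ∘ ξ) = 0) :
    ∃ μ ν : K, (μ ≠ 0 ∨ ν ≠ 0) ∧ μ • k₁ + ν • k₂ ∈ radicalMaps ξ t := by
  obtain ⟨μ, ν, hμν, hker⟩ := exists_altMatrix_mulVec_eq_zero ht hpf h
  exact ⟨μ, ν, hμν, mem_radicalMaps.2 hker⟩

lemma frob_sq_comp_mem_radicalMaps [Finite F] (ht : ∀ i, t i ^ (Nat.card F ^ 2) = t i)
    {g : K →ₗ[F] K} (hg : g ∈ radicalMaps ξ t) :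
    (frob F ^ 2 : K →ₐ[F] K).toLinearMap ∘ₗ g ∈ radicalMaps ξ t := by
  rw [mem_radicalMaps] at hg ⊢
  let σ : K →+* K := (frob F ^ 2 : K →ₐ[F] K)
  have hσ : σ ∘ t = t := funext fun i => (frob_pow_apply F 2 (t i)).trans (ht i)
  have hmul := RingHom.map_mulVec σ (altMatrix t) (g ∘ ξ)
  rw [map_altMatrix, hσ, hg] at hmul
  exact funext fun i => (hmul i).symm.trans (map_zero σ)

end RadicalMaps

lemma exists_finrank_eq_two_frob_sq_stable (h4 : finrank F K = 4)
    {D : Submodule K (K →ₗ[F] K)} (hD : finrank K D = 2) :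
    ∃ W : Submodule K (K →ₗ[F] K), finrank K W = 2 ∧
      (∀ g ∈ W, (frob F ^ 2 : K →ₐ[F] K).toLinearMap ∘ₗ g ∈ W) ∧
      (∃ c ∈ D, c ≠ 0 ∧ c ∈ W) ∧ ∃ a ∈ D, a ≠ 0 ∧ (frob F).toLinearMap ∘ₗ a ∈ W := by
  have : Finite K := Module.finite_of_finite F
  obtain ⟨k₁, hk₁, k₂, hk₂, hli⟩ := exists_linearIndependent_pair_of_mem (hD ▸ one_lt_two)
  let ξ : Basis (Fin 4) F K := finBasisOfFinrankEq F K h4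
  obtain ⟨t, ht, hpf, htq, h, hfrob⟩ :=
    exists_isotropic_pfaffian_eq_zero h4 (plucker (k₁ ∘ ξ) (k₂ ∘ ξ))
  have hne {μ ν : K} (hμν : μ ≠ 0 ∨ ν ≠ 0) : μ • k₁ + ν • k₂ ≠ 0 := fun h0 => by
    obtain ⟨hμ, hν⟩ := LinearIndependent.pair_iff.1 hli μ ν h0
    exact hμν.elim (· hμ) (· hν)
  have hmem (μ ν : K) : μ • k₁ + ν • k₂ ∈ D := D.add_mem (D.smul_mem μ hk₁) (D.smul_mem ν hk₂)
  refine ⟨radicalMaps ξ t, finrank_radicalMaps ht hpf,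
    fun g hg => frob_sq_comp_mem_radicalMaps htq hg, ?_, ?_⟩
  · obtain ⟨μ, ν, hμν, hker⟩ := exists_smul_add_smul_mem_radicalMaps ht hpf h
    exact ⟨_, hmem μ ν, hne hμν, hker⟩
  · have hsurj := Finite.surjective_of_injective (frob_injective F (K := K))
    rw [← AlgHom.coe_toRingHom, ← map_plucker] at hfrob
    obtain ⟨μ, ν, hμν, hker⟩ := exists_smul_add_smul_mem_radicalMaps (ξ := ξ) ht hpf
      (k₁ := (frob F).toLinearMap ∘ₗ k₁) (k₂ := (frob F).toLinearMap ∘ₗ k₂) hfrob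
    obtain ⟨μ, rfl⟩ := hsurj μ
    obtain ⟨ν, rfl⟩ := hsurj ν
    rw [map_ne_zero, map_ne_zero] at hμν
    refine ⟨_, hmem μ ν, hne hμν, ?_⟩
    convert hker using 1
    ext x
    simp

section Pencil

variable {D : Submodule K (K →ₗ[F] K)}

lemma exists_eq_frob_add_frob_pow_three (h4 : finrank F K = 4) (hD : finrank K D = 2)
    (hsc : ∀ g ∈ D, g ≠ 0 → 3 ≤ finrank F g.range) :
    ∃ a ∈ D, ∃ c ∈ D, LinearIndependent K ![a, c] ∧
      ∃ α β : K, ∀ x, c x = α * a x ^ Nat.card F + β * a x ^ (Nat.card F ^ 3) := by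
  obtain ⟨W, hW, hstable, ⟨c, hcD, hc0, hcW⟩, a, haD, ha0, haW⟩ :=
    exists_finrank_eq_two_frob_sq_stable h4 hD
  have : FiniteDimensional K W := FiniteDimensional.of_finrank_eq_succ hW
  have haW3 : (frob F ^ 2 : K →ₐ[F] K).toLinearMap ∘ₗ (frob F).toLinearMap ∘ₗ a ∈ W :=
    hstable _ haW
  have ha : LinearIndependent K ![a, c] := by
    refine (LinearIndependent.pair_iff' ha0).2 ?_
    rintro s rfl
    have haW0 : a ∈ W := by
      rwa [Submodule.smul_mem_iff _ (smul_ne_zero_iff.1 hc0).1] at hcW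
    have hle : Submodule.span K (Set.range fun i : Fin 3 =>
        (frob F ^ (i : ℕ) : K →ₐ[F] K).toLinearMap ∘ₗ a) ≤ W := by
      rw [Submodule.span_le, Set.range_subset_iff, Fin.forall_fin_succ, Fin.forall_fin_two]
      exact ⟨haW0, haW, hstable a haW0⟩
    have h := Submodule.finrank_mono hle
    rw [finrank_span_eq_card (linearIndependent_frob_pow_comp (hsc a haD ha0)), hW,
      Fintype.card_fin] at h
    omega
  have hrange : finrank F ((frob F).toLinearMap ∘ₗ a).range = finrank F a.range := by
    rw [LinearMap.range_comp]
    exact (Submodule.equivMapOfInjective _ (frob_injective F) a.range).finrank_eq.symm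
  have hli : LinearIndependent K ![(frob F).toLinearMap ∘ₗ a,
      (frob F ^ 2 : K →ₐ[F] K).toLinearMap ∘ₗ (frob F).toLinearMap ∘ₗ a] := by
    have h := (linearIndependent_frob_pow_comp (hrange ▸ hsc a haD ha0)).comp ![0, 2] (by decide)
    convert h using 1
    ext i : 1
    fin_cases i <;> rfl
  obtain ⟨α, β, hc⟩ := Submodule.mem_span_pair.1
    ((span_pair_eq_of_finrank_eq_two hW haW haW3 hli).ge hcW)
  refine ⟨a, haD, c, hcD, ha, α, β, fun x => ?_⟩
  rw [← hc, pow_succ' _ 2, pow_mul, ← frob_apply, ← frob_pow_apply]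
  rfl

lemma norm_ne_one_of_forall_le_finrank_range (h4 : finrank F K = 4)
    (hsc : ∀ g ∈ D, g ≠ 0 → 3 ≤ finrank F g.range) {u v : K →ₗ[F] K}
    (hu : u ∈ D) (hv : v ∈ D) (huv : LinearIndependent K ![u, v]) (hsurj : Function.Surjective u)
    {δ : K} (hδ : ∀ x, v x = u x ^ Nat.card F + δ * u x ^ (Nat.card F ^ 3)) :
    Algebra.norm F δ ≠ 1 := by
  intro h1
  obtain ⟨x, y, hxy, h⟩ := exists_pair_of_norm_eq_one (by norm_num) h4 h1
  obtain ⟨x, rfl⟩ := hsurj x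
  obtain ⟨y, rfl⟩ := hsurj y
  rw [← hδ, ← hδ] at h
  have hux : u x ≠ 0 := hxy.ne_zero 0
  have hx : x ≠ 0 := fun hx => hux (by rw [hx, map_zero])
  let g : K →ₗ[F] K := -v x • u + u x • v
  have hg (z : K) : g z = -v x * u z + u x * v z := rfl
  have hg0 : g ≠ 0 := fun hg0 => hux (LinearIndependent.pair_iff.1 huv _ _ hg0).2
  have hrange := hsc g (D.add_mem (D.smul_mem _ hu) (D.smul_mem _ hv)) hg0
  have hker := g.finrank_range_add_finrank_ker
  obtain ⟨s, rfl⟩ := exists_smul_of_finrank_ker_le_one (x := x) (y := y) (f := g) (by omega) hx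
    (by rw [hg]; ring) (by rw [hg]; linear_combination h)
  exact (LinearIndependent.pair_iff' hux).1 hxy s (map_smul u s x).symm

variable {C : Submodule K (Fin (4 + 1) → K)}

omit [FiniteDimensional F K] [Finite F] in
lemma IsPencilOf.injective_of_ker_le (hD : IsPencilOf D C) {u v : K →ₗ[F] K} (hu : u ∈ D)
    (hv : v ∈ D) (huv : LinearIndependent K ![u, v]) (hker : u.ker ≤ v.ker) :
    Function.Injective u := by
  rw [← LinearMap.ker_eq_bot, ← disjoint_self]
  exact (hD.disjoint_ker hu hv huv).mono_right hker

lemma isRankFourForm_frob : IsRankFourForm (frob F : K →ₐ[F] K).toLinearMap :=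
  .inl ⟨0, by simp [Algebra.norm_zero], fun x => by
    rw [zero_mul, add_zero]
    exact frob_apply F x⟩

lemma IsPencilOf.exists_isRankFourForm_of_forall_le_finrank_range (hD : IsPencilOf D C)
    (h4 : finrank F K = 4) (hsc : ∀ g ∈ D, g ≠ 0 → 3 ≤ finrank F g.range) :
    ∃ f : K →ₗ[F] K, IsRankFourForm f ∧ IsRepresentedBy F C f := by
  obtain ⟨a, ha, c, hc, hac, α, β, h⟩ := exists_eq_frob_add_frob_pow_three h4 hD.finrank_eq hsc
  have hinj : Function.Injective a := by
    refine hD.injective_of_ker_le ha hc hac fun x hx => ?_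
    have hq : Nat.card F ≠ 0 := Nat.card_pos.ne'
    rw [LinearMap.mem_ker] at hx ⊢
    rw [h, hx, zero_pow hq, zero_pow (pow_ne_zero 3 hq), mul_zero, mul_zero, add_zero]
  by_cases hα : α = 0
  · have hβ : β ≠ 0 := fun hβ => hac.ne_zero 1 (LinearMap.ext fun x => by simp [h, hα, hβ])
    have hli : LinearIndependent K ![β⁻¹ • c, a] := by
      have hli := linearIndependent_smul_pair one_ne_zero (inv_ne_zero hβ) hac
      rwa [one_smul, LinearIndependent.pair_symm_iff] at hli
    have hu (x : K) : (β⁻¹ • c) x = a x ^ (Nat.card F ^ 3) := by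
      rw [LinearMap.smul_apply, h, hα, zero_mul, zero_add, smul_eq_mul, inv_mul_cancel_left₀ hβ]
    refine ⟨(frob F).toLinearMap, isRankFourForm_frob,
      hD.isRepresentedBy (D.smul_mem _ hc) ha hli (fun x y hxy => hinj ?_) fun x => ?_⟩
    · rw [hu, hu, ← frob_pow_apply, ← frob_pow_apply] at hxy
      exact (frob F ^ 3 : K →ₐ[F] K).toRingHom.injective hxy
    · rw [hu]
      change frob F (a x ^ (Nat.card F ^ 3)) = a x
      have hfix := pow_card_pow_finrank F (a x)
      rw [h4, pow_succ, pow_mul] at hfix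
      rwa [frob_apply]
  · let f : K →ₗ[F] K := (frob F).toLinearMap + (β / α) • (frob F ^ 3 : K →ₐ[F] K).toLinearMap
    have hf (x : K) : f x = x ^ Nat.card F + β / α * x ^ (Nat.card F ^ 3) := by
      rw [← frob_apply, ← frob_pow_apply]
      rfl
    have hli : LinearIndependent K ![a, α⁻¹ • c] := by
      have hli := linearIndependent_smul_pair one_ne_zero (inv_ne_zero hα) hac
      rwa [one_smul] at hli
    have hv (x : K) : (α⁻¹ • c) x = f (a x) := by
      rw [LinearMap.smul_apply, h, hf, smul_eq_mul]
      field_simp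
    refine ⟨f, .inl ⟨β / α, ?_, hf⟩,
      hD.isRepresentedBy ha (D.smul_mem _ hc) hli hinj fun x => (hv x).symm⟩
    exact norm_ne_one_of_forall_le_finrank_range h4 hsc ha (D.smul_mem _ hc) hli
      (LinearMap.surjective_of_injective hinj) fun x => (hv x).trans (hf _)

end Pencil

end Scattered

section Classification

variable {F K : Type*} [Field F] [Field K] [Algebra F K] {n : ℕ}

lemma IsCode.exists_rankWeight_eq {N k d : ℕ} {C : Submodule K (Fin N → K)} (hC : IsCode F C k d) :
    ∃ c ∈ C, rankWeight F c = d := by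
  obtain ⟨x, hx, y, hy, -, hd⟩ := hC.2.1
  exact ⟨x - y, sub_mem hx hy, hd.symm⟩

variable {D : Submodule K (K →ₗ[F] K)}

lemma exists_mem_ne_zero_apply_eq_zero (hD : 1 < finrank K D) (x : K) :
    ∃ g ∈ D, g ≠ 0 ∧ g x = 0 := by
  obtain ⟨u, hu, v, hv, huv⟩ := exists_linearIndependent_pair_of_mem hD
  by_cases hux : u x = 0
  · exact ⟨u, hu, huv.ne_zero 0, hux⟩
  · refine ⟨v x • u + (-u x) • v, D.add_mem (D.smul_mem _ hu) (D.smul_mem _ hv),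
      fun h => hux (neg_eq_zero.1 (LinearIndependent.pair_iff.1 huv _ _ h).2), ?_⟩
    simp only [LinearMap.add_apply, LinearMap.smul_apply, smul_eq_mul]
    ring

variable [FiniteDimensional F K]

lemma two_lt_finrank_of_finrank_range_ne_one (hD : 1 < finrank K D)
    (h1 : ∀ g ∈ D, finrank F g.range ≠ 1) : 2 < finrank F K := by
  obtain ⟨g, hg, hg0, hg1⟩ := exists_mem_ne_zero_apply_eq_zero hD 1
  have hker : 0 < finrank F g.ker :=
    Submodule.one_le_finrank_iff.2 ((Submodule.ne_bot_iff _).2 ⟨1, hg1, one_ne_zero⟩)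
  have hrange : 0 < finrank F g.range :=
    Submodule.one_le_finrank_iff.2 (LinearMap.range_eq_bot.not.2 hg0)
  have := g.finrank_range_add_finrank_ker
  have := h1 g hg
  omega

lemma exists_isThinOutsideKer_range_eq_span_one (hK : 2 < finrank F K) (hid : LinearMap.id ∈ D)
    {g : K →ₗ[F] K} (hg : g ∈ D) (hg2 : finrank F g.range = 2)
    (hthin : ∀ h ∈ D, h ∉ Submodule.span K {g} → finrank F K - 1 ≤ finrank F h.range) :
    ∃ f ∈ D, LinearIndependent K ![LinearMap.id, f] ∧ IsThinOutsideKer f ∧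
      ∃ b : K, LinearIndependent F ![1, b] ∧ f.range = Submodule.span F {1, b} := by
  obtain ⟨a, b, ha, hb, hab⟩ := exists_map_mulLeft_eq_span_one hg2
  obtain ⟨x, hx, hgx⟩ := exists_ne_zero_apply_eq_zero (hg2 ▸ hK)
  have hli : LinearIndependent K ![LinearMap.id, a • g] :=
    linearIndependent_id_of_apply_eq_zero
      (smul_ne_zero ha (ne_zero_of_finrank_range_eq_two hg2)) hx
      (by rw [LinearMap.smul_apply, hgx, smul_zero])
  refine ⟨a • g, D.smul_mem a hg, hli, ?_, b, hb, range_smul_eq_map_mulLeft a g ▸ hab⟩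
  refine isThinOutsideKer_of_le_finrank_range hid (D.smul_mem a hg) hli ?_
  rwa [Submodule.span_singleton_smul_eq (IsUnit.mk0 a ha)]

lemma IsPencilOf.exists_isRankFourForm {C : Submodule K (Fin (4 + 1) → K)}
    (hD : IsPencilOf D C) [Finite F] (h4 : finrank F K = 4) (hC : IsQNondegenerate F C) :
    ∃ f : K →ₗ[F] K, IsRankFourForm f ∧ IsRepresentedBy F C f := by
  by_cases h1 : ∃ g ∈ D, finrank F g.range = 1
  · obtain ⟨g, hg, hg1⟩ := h1
    exact ⟨traceMap F K, .inr (.inl traceMap_apply), hD.isRepresentedBy_traceMap (by omega) hg hg1⟩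
  push Not at h1
  have h0 : ∀ g ∈ D, g ≠ 0 → finrank F g.range ≠ 0 := fun g _ hg0 h =>
    hg0 (LinearMap.range_eq_bot.1 (Submodule.finrank_eq_zero.1 h))
  by_cases h2 : ∃ g ∈ D, finrank F g.range = 2
  · obtain ⟨g, hg, hg2⟩ := h2
    have hg0 := ne_zero_of_finrank_range_eq_two hg2
    by_cases hunique : ∀ h ∈ D, finrank F h.range = 2 → h ∈ Submodule.span K {g}
    · obtain ⟨f, hf, hli, hthin, b, hb, hr⟩ :=
        exists_isThinOutsideKer_range_eq_span_one (by omega) hD.id_mem hg hg2 fun h hh hhg => by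
          have := h1 h hh
          have := h0 h hh fun h => hhg (h ▸ Submodule.zero_mem _)
          have := mt (hunique h hh) hhg
          omega
      exact hD.exists_isRankFourForm_of_isThinOutsideKer hf hli hthin h4 hb hr
    · push Not at hunique
      obtain ⟨h, hh, hh2, hhg⟩ := hunique
      have hli : LinearIndependent K ![g, h] := (LinearIndependent.pair_iff' hg0).2
        fun a ha => hhg (Submodule.mem_span_singleton.2 ⟨a, ha⟩)
      exact hD.exists_isRankFourForm_of_finrank_range_eq_two h4
        (hD.exists_finrank_ker_eq_one hC (by omega)) hg hh hli hg2 hh2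
  · push Not at h2
    refine hD.exists_isRankFourForm_of_forall_le_finrank_range h4 fun g hg hg0 => ?_
    have := h0 g hg hg0
    have := h1 g hg
    have := h2 g hg
    omega

lemma IsPencilOf.exists_isTraceClubForm [Finite F]
    {C : Submodule K (Fin (n + 1) → K)} (hD : IsPencilOf D C) (hn : finrank F K = n)
    (h1 : numCodewords F C (fun w => w = 1) = Nat.card K - 1)
    (h2 : numCodewords F C (fun w => w = 2) = (Nat.card K - 1) * Nat.card F ^ 2)
    (h3 : numCodewords F C (fun w => 3 ≤ w ∧ w < n - 1) ≤
      (Nat.card K - 1) * (Nat.card K - Nat.card F ^ 2)) :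
    ∃ f : K →ₗ[F] K, IsTraceClubForm f ∧ IsClubPolynomial (n - 2) f ∧ IsRepresentedBy F C f := by
  have : Finite K := Module.finite_of_finite F
  have hK : 2 < finrank F K := two_lt_finrank_of_finrank_range_ne_one
    (hD.finrank_eq ▸ one_lt_two) fun g => hD.finrank_range_ne_one h1
  obtain ⟨g, hg, hg2, hrange⟩ := hD.exists_finrank_range_eq_two_and_le h1 h2 h3
  obtain ⟨f, hf, hli, hthin, b, hb, hr⟩ :=
    exists_isThinOutsideKer_range_eq_span_one hK hD.id_mem hg hg2 (hn ▸ hrange)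
  have hker := finrank_ker_add_two hb hr
  have hclub := hthin.isClubPolynomial fun h => by
    rw [h, finrank_bot] at hker
    omega
  rw [show finrank F f.ker = n - 2 by omega] at hclub
  exact ⟨f, hthin.isTraceClubForm hb hr, hclub,
    hD.isRepresentedBy hD.id_mem hf hli Function.injective_id fun _ => rfl⟩

end Classification

end RankMetric

open RankMetric in
theorem mainTheorem12 {F K : Type*} [Field F] [Field K] [Algebra F K] [Finite F] [Finite K]
    (q n : ℕ) (hq : Nat.card F = q) (hn : Module.finrank F K = n)
    (C : Submodule K (Fin (n + 1) → K))
    (hC : IsCode F C 3 1) (hnd : IsQNondegenerate F C) :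
    (∀ U : Submodule F (Fin 3 → K), IsAssociatedSystem F C U → IsLinearRedeiBlockingSet U) ∧
    (q ^ n - 1 < numCodewords F C (fun w => w = 1) →
      ∀ ξ : Module.Basis (Fin n) F K, SemilinearlyEquivalent F C (genCode ξ (Tr F))) ∧
    (n = 4 → ∃ f : K →ₗ[F] K, IsRankFourForm f ∧
      ∀ ξ : Module.Basis (Fin n) F K, SemilinearlyEquivalent F C (genCode ξ f)) ∧
    (numCodewords F C (fun w => w = 1) = q ^ n - 1 →
      numCodewords F C (fun w => w = 2) = (q ^ n - 1) * q ^ 2 →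
      numCodewords F C (fun w => 3 ≤ w ∧ w < n - 1) ≤ (q ^ n - 1) * (q ^ n - q ^ 2) →
      ∃ f : K →ₗ[F] K, IsTraceClubForm f ∧ IsClubPolynomial (n - 2) f ∧
        ∀ ξ : Module.Basis (Fin n) F K, SemilinearlyEquivalent F C (genCode ξ f)) := by
  have : FiniteDimensional F K := Module.Finite.of_finite
  have hcard : q ^ n = Nat.card K := by
    rw [← hq, ← hn, Module.natCard_eq_pow_finrank (K := F) (V := K)]
  have hn2 : 2 ≤ finrank F K := by
    have := C.finrank_le
    rw [hC.1, finrank_fin_fun] at this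
    omega
  obtain ⟨c, hc, hc1⟩ := hC.exists_rankWeight_eq
  obtain ⟨D, hD⟩ := exists_isPencilOf hn hC.1 hnd.1 hc hc1
  rw [hcard]
  subst hq
  refine ⟨fun U hU => isLinearRedeiBlockingSet hn hnd.1 hc hc1 hU, fun h => ?_, ?_,
    fun h1 h2 h3 => hD.exists_isTraceClubForm hn h1 h2 h3⟩
  · obtain ⟨g, hg, hg1⟩ := hD.exists_finrank_range_eq_one h
    exact hD.isRepresentedBy_traceMap hn2 hg hg1
  · rintro rfl
    exact hD.exists_isRankFourForm hn hnd
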